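/- Let $F$ be an algebraically closed field of characteristic $p>0$, and let $L$ be a finite-dimensional restricted Lie algebra over $F$, with $p$-mapping $x\mapsto x^{[p]}$. A restricted subalgebra of $L$ is a Lie subalgebra closed under the $p$-mapping; ordered by inclusion, the restricted subalgebras of $L$ form a lattice in which the meet of $S$ and $T$ is $S\cap T$ and the join $\langle S,T\rangle_p$ is the smallest restricted subalgebra containing $S$ and $T$. The following conditions are equivalent: (i) $L$ is upper semimodular: for all restricted subalgebras $S,T$ of $L$ such that $S\cap T$ is a maximal (proper) restricted subalgebra of $T$, $S$ is a maximal (proper) restricted subalgebra of $\langle S,T\rangle_p$; (ii) $L$ is modular: for all restricted subalgebras $X,Y,Z$ of $L$ with $X\subseteq Z$, one has $\langle X,Y\rangle_p\cap Z=\langle X,Y\cap Z\rangle_p$; (iii) every restricted subalgebra $S$ of $L$ is a restricted quasi-ideal, that is, $[S,H]\subseteq S+H$ for every restricted subalgebra $H$ of $L$. Moreover, if one of these conditions holds, then either $L$ is almost abelian, that is, $L=Fx\dotplus A$ (a direct sum of vector spaces, $x\neq 0$) where $A$ is an abelian ideal of $L$ and $[x,a]=a$ for all $a\in A$, or $L$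 is nilpotent of class at most $2$, that is, $[[L,L],L]=0$. (The two alternatives are not exclusive.) -/

import Mathlib

/-- For elements `a, b` of a Lie algebra, `jacobsonCoeff a b n k` is the coefficient of `X ^ k` in
`(ad (a X + b)) ^ n (a)`, computed in `L[X] = L ⊗ F[X]`. -/
def jacobsonCoeff {L : Type*} [LieRing L] (a b : L) : ℕ → ℕ → L
  | 0, 0 => a
  | 0, _ + 1 => 0
  | n + 1, 0 => ⁅b, jacobsonCoeff a b n 0⁆
  | n + 1, k + 1 => ⁅a, jacobsonCoeff a b n k⁆ + ⁅b, jacobsonCoeff a b n (k + 1)⁆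

/-- Jacobson's polynomials `s_i(a, b)`, `1 ≤ i ≤ p - 1`: in characteristic `p` they are determined by
`(ad (a X + b)) ^ (p - 1) (a) = ∑_{i = 1}^{p - 1} i s_i(a, b) X ^ (i - 1)`. -/
def jacobsonS (F : Type*) (p : ℕ) {L : Type*} [Field F] [LieRing L] [LieAlgebra F L]
    (i : ℕ) (a b : L) : L :=
  (i : F)⁻¹ • jacobsonCoeff a b (p - 1) (i - 1)

/-- A restricted Lie algebra over a field `F` of prime characteristic `p`: a Lie algebra over `F`
with a `p`-mapping `x ↦ x^[p]`. -/
class RestrictedLieAlgebra (F : Type*) (p : ℕ) (L : Type*) [Field F] [Fact p.Prime] [CharP F p]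
    [LieRing L] [LieAlgebra F L] where
  /-- the `p`-mapping -/
  pMap : L → L
  ad_pMap : ∀ x : L, LieAlgebra.ad F L (pMap x) = LieAlgebra.ad F L x ^ p
  pMap_smul : ∀ (c : F) (x : L), pMap (c • x) = c ^ p • pMap x
  pMap_add : ∀ x y : L,
    pMap (x + y) = pMap x + pMap y + ∑ i ∈ Finset.Icc 1 (p - 1), jacobsonS F p i x y

/-- A restricted subalgebra: a Lie subalgebra closed under the `p`-mapping. -/
structure RestrictedSubalgebra (F : Type*) (p : ℕ) (L : Type*) [Field F] [Fact p.Prime] [CharP F p]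
    [LieRing L] [LieAlgebra F L] [RestrictedLieAlgebra F p L] extends LieSubalgebra F L where
  pMap_mem' : ∀ {x : L}, x ∈ carrier → RestrictedLieAlgebra.pMap F p x ∈ carrier

namespace RestrictedSubalgebra

variable {F : Type*} {p : ℕ} {L : Type*} [Field F] [Fact p.Prime] [CharP F p]
  [LieRing L] [LieAlgebra F L] [RestrictedLieAlgebra F p L]

theorem toLieSubalgebra_injective :
    Function.Injective (toLieSubalgebra : RestrictedSubalgebra F p L → LieSubalgebra F L) := by
  rintro ⟨S, _⟩ ⟨T, _⟩ h
  cases h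
  rfl

instance : SetLike (RestrictedSubalgebra F p L) L where
  coe S := (S.toLieSubalgebra : Set L)
  coe_injective _ _ h := toLieSubalgebra_injective (SetLike.coe_injective h)

/-- Restricted subalgebras are ordered by inclusion. -/
instance : PartialOrder (RestrictedSubalgebra F p L) :=
  PartialOrder.lift (fun S => (S : Set L)) SetLike.coe_injective

/-- Intersection of a family of restricted subalgebras. -/
instance : InfSet (RestrictedSubalgebra F p L) where
  sInf A :=
    { carrier := {x | ∀ S ∈ A, x ∈ S.toLieSubalgebra}
      add_mem' := fun hx hy S hS => S.toLieSubalgebra.add_mem (hx S hS) (hy S hS)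
      zero_mem' := fun S _ => S.toLieSubalgebra.zero_mem
      smul_mem' := fun c _ hx S hS => S.toLieSubalgebra.smul_mem c (hx S hS)
      lie_mem' := fun hx hy S hS => S.toLieSubalgebra.lie_mem (hx S hS) (hy S hS)
      pMap_mem' := fun hx S hS => S.pMap_mem' (hx S hS) }

/-- The lattice of restricted subalgebras: the meet is the intersection, and the join `S ⊔ T` is
the smallest restricted subalgebra containing `S` and `T`. -/
instance : CompleteLattice (RestrictedSubalgebra F p L) :=
  completeLatticeOfInf _ fun _ => ⟨fun _ hS _ hx => hx _ hS, fun _ hT _ hx S hS => hT hS hx⟩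

/-- `S` is a restricted quasi-ideal: `[S, H] ⊆ S + H` for all restricted subalgebras `H`. -/
def IsQuasiIdeal (S : RestrictedSubalgebra F p L) : Prop :=
  ∀ H : RestrictedSubalgebra F p L, ∀ s ∈ S, ∀ h ∈ H, ⁅s, h⁆ ∈ S.toSubmodule ⊔ H.toSubmodule

end RestrictedSubalgebra

/-- `L` is almost abelian: `L = F x ∔ A` (a direct sum of vector spaces, `x ≠ 0`), where `A` is an
abelian ideal and `ad x` is the identity on `A`. -/
def IsAlmostAbelian (F : Type*) (L : Type*) [Field F] [LieRing L] [LieAlgebra F L] : Prop :=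
  ∃ (x : L) (A : LieIdeal F L), x ≠ 0 ∧ IsCompl (Submodule.span F {x}) A.toSubmodule ∧
    (∀ a ∈ A, ∀ b ∈ A, ⁅a, b⁆ = 0) ∧ ∀ a ∈ A, ⁅x, a⁆ = a

set_option linter.unusedSectionVars false

/-! Modularity trivially gives upper semimodularity. If every restricted subalgebra is a
quasi-ideal, joins are sums of vector spaces, and the modular law is inherited from subspaces. The
substance is that upper semimodularity forces quasi-ideals and the stated structure.

The main tool is linear algebra of a `p`-semilinear map `f` over an algebraically closed field: `f z
- z = v` is always solvable (`exists_sub_eq`), and modulo a subspace there is always a vector that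
is killed or fixed (`exists_notMem`). On a commutative restricted subalgebra the `p`-mapping is such
an `f`.

A line spanned by a vector that the `p`-mapping kills or fixes is an atom. By semimodularity the
join of two such lines covers both, and `lie_mem_span_of_isUpperModularLattice` deduces that their
generators span a subalgebra. If some toral `t` (that is, `φ t = t`) is not central, testing this
property on vectors built from `t` and its weight vectors forces `t` to have centralizer `F t` and a
single nonzero weight, so `L` is almost abelian; there any two elements span a subalgebra.

If all toral elements are central, `L` is nilpotent by Engel's theorem. Then covers raise the
dimension by one, and semimodularity bounds the dimension of a join by that of the sum
(`finrank_sup_add_finrank_inf_le`), so joins are sums. Finally, writing `[x, y]` in `⟨x⟩_p + ⟨y⟩_p`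
and filtering by iterated brackets with `x` and `y` gives first `[x, [x, y]] = 0`, then class at
most 2. -/

open Polynomial in
/-- For a `p`-semilinear map `f` and a relation `f^[m+1] v = ∑ c_i • f^[i] v`, the values of these
polynomials at a root `e` of `D_m ^ p = X` are the coordinates of some `z` with
`f z = z - a • v`. -/
noncomputable def semilinearCoord {F : Type*} [Field F] (p : ℕ) (a : F) (c : ℕ → F) : ℕ → F[X]
  | 0 => C (c 0) * X + C a
  | i + 1 => semilinearCoord p a c i ^ p + C (c (i + 1)) * X

/-! ### `p`-semilinear maps over an algebraically closed field -/

section Semilinear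

open Polynomial

variable {F : Type*} [Field F] {p : ℕ} [Fact p.Prime] [CharP F p]

/-- The derivative of `D_m ^ p - X` is `-1`, so this polynomial is not constant. -/
theorem exists_root_semilinearCoord [IsAlgClosed F] (a : F) (c : ℕ → F) (m : ℕ) :
    ∃ e : F, (semilinearCoord p a c m).eval e ^ p = e := by
  have hd : derivative (semilinearCoord p a c m ^ p - X) = -1 := by
    simp [derivative_pow]
  have hdeg : (semilinearCoord p a c m ^ p - X).degree ≠ 0 := by
    intro h
    rw [eq_C_of_degree_eq_zero h] at hd
    simp at hd
  obtain ⟨e, he⟩ := IsAlgClosed.exists_root _ hdeg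
  exact ⟨e, by simpa [sub_eq_zero] using he⟩

theorem semilinearCoord_eval_zero (c : ℕ → F) (m : ℕ) :
    (semilinearCoord p 0 c m).eval 0 = 0 := by
  have hp : p ≠ 0 := (Fact.out : p.Prime).ne_zero
  induction m with
  | zero => simp [semilinearCoord]
  | succ m ih => simp [semilinearCoord, ih, hp]

/-- Differentiating kills the `p`-th power in the recursion and isolates the last `c`; then descend.
-/
theorem coeff_eq_zero_of_semilinearCoord_eq_zero (c : ℕ → F) (m : ℕ)
    (h : semilinearCoord p 0 c m = 0) : ∀ i ≤ m, c i = 0 := by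
  induction m with
  | zero =>
    intro i hi
    obtain rfl : i = 0 := by omega
    simpa [semilinearCoord] using h
  | succ m ih =>
    have hp := (Fact.out : p.Prime)
    have hc : c (m + 1) = 0 := by
      have := congrArg derivative h
      simpa [semilinearCoord, derivative_pow] using this
    have h0 : semilinearCoord p 0 c m = 0 := by
      simp only [semilinearCoord, hc, map_zero, zero_mul, add_zero] at h
      exact pow_eq_zero_iff hp.ne_zero |>.1 h
    intro i hi
    rcases Nat.lt_or_ge m i with h' | h'
    · obtain rfl : i = m + 1 := by omega
      exact hc
    · exact ih h0 i h'

/-- For `a = 0` the root `0` is useless. Writing `D_m = X R`, the remaining roots are those of `X ^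
(p - 1) R ^ p - 1`, which is not constant and does not vanish at `0`. -/
theorem exists_ne_zero_root_semilinearCoord [IsAlgClosed F] (c : ℕ → F) (m : ℕ)
    (h : semilinearCoord p 0 c m ≠ 0) :
    ∃ e : F, e ≠ 0 ∧ (semilinearCoord p 0 c m).eval e ^ p = e := by
  have hp := (Fact.out : p.Prime)
  obtain ⟨R, hR⟩ : X ∣ semilinearCoord p 0 c m := by
    rw [X_dvd_iff, coeff_zero_eq_eval_zero, semilinearCoord_eval_zero]
  have hR0 : R ≠ 0 := by
    rintro rfl
    simp [hR] at h
  have hdeg : (X ^ (p - 1) * R ^ p - 1 : F[X]).degree ≠ 0 := by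
    intro h
    have h1 : (X ^ (p - 1) * R ^ p : F[X]).natDegree = 0 := by
      have := natDegree_eq_zero_iff_degree_le_zero.2 h.le
      rwa [← C_1, natDegree_sub_C] at this
    rw [natDegree_mul (pow_ne_zero _ X_ne_zero) (pow_ne_zero _ hR0), natDegree_X_pow] at h1
    have := hp.two_le
    omega
  obtain ⟨e, he⟩ := IsAlgClosed.exists_root _ hdeg
  have he' : e ^ (p - 1) * R.eval e ^ p = 1 := by simpa [sub_eq_zero] using he
  have he0 : e ≠ 0 := by
    rintro rfl
    have : p - 1 ≠ 0 := by have := hp.two_le; omega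
    simp [this] at he'
  refine ⟨e, he0, ?_⟩
  rw [hR, eval_mul, eval_X, mul_pow]
  have : e ^ p = e ^ (p - 1) * e := by
    rw [← pow_succ]; congr 1; have := hp.two_le; omega
  rw [this]
  linear_combination e * he'

variable {V : Type*} [AddCommGroup V] [Module F V]

/-- A `p`-semilinear map on a submodule `B` of `V`, given by a map of `V`. -/
structure IsSemilinearOn (F : Type*) {V : Type*} [Field F] [AddCommGroup V] [Module F V]
    (p : ℕ) (f : V → V) (B : Submodule F V) : Prop where
  mem : ∀ x ∈ B, f x ∈ B
  add : ∀ x ∈ B, ∀ y ∈ B, f (x + y) = f x + f y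
  smul : ∀ (c : F), ∀ x ∈ B, f (c • x) = c ^ p • f x

namespace IsSemilinearOn

variable {f : V → V} {B : Submodule F V}

theorem iterate_mem (hf : IsSemilinearOn F p f B) {v : V} (hv : v ∈ B) (i : ℕ) :
    f^[i] v ∈ B := by
  induction i with
  | zero => exact hv
  | succ i ih => rw [Function.iterate_succ_apply']; exact hf.mem _ ih

theorem map_zero (hf : IsSemilinearOn F p f B) : f 0 = 0 := by
  have := hf.smul 0 0 B.zero_mem
  have hp : p ≠ 0 := (Fact.out : p.Prime).ne_zero
  simpa [hp] using this

theorem map_sum (hf : IsSemilinearOn F p f B) {g : ℕ → V} (hg : ∀ i, g i ∈ B) (n : ℕ) :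
    f (∑ i ∈ Finset.range n, g i) = ∑ i ∈ Finset.range n, f (g i) := by
  induction n with
  | zero => simpa using hf.map_zero
  | succ n ih =>
    rw [Finset.sum_range_succ, Finset.sum_range_succ,
      hf.add _ (B.sum_mem fun i _ => hg i) _ (hg n), ih]

/-- The recursion for the coordinates matches coefficients of each `f^[i] v`. The last two terms
cancel once `D_m(e) ^ p = e` and the relation for `f^[m + 1] v` holds, and the second use needs that
relation only modulo a subspace. -/
theorem map_coord (hf : IsSemilinearOn F p f B) {v : V} (hv : v ∈ B) (a e : F) (c : ℕ → F) (m : ℕ) :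
    f (∑ i ∈ Finset.range (m + 1), (semilinearCoord p a c i).eval e • f^[i] v) =
      (∑ i ∈ Finset.range (m + 1), (semilinearCoord p a c i).eval e • f^[i] v) - a • v +
      (semilinearCoord p a c m).eval e ^ p • f^[m + 1] v -
      e • ∑ i ∈ Finset.range (m + 1), c i • f^[i] v := by
  rw [hf.map_sum fun i => B.smul_mem _ (hf.iterate_mem hv i)]
  simp only [hf.smul _ _ (hf.iterate_mem hv _), ← Function.iterate_succ_apply' f]
  induction m with
  | zero =>
    simp only [semilinearCoord, Finset.sum_range_succ, Finset.sum_range_zero, eval_add, eval_mul,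
      eval_C, eval_X, Function.iterate_zero_apply, zero_add]
    module
  | succ m ih =>
    rw [Finset.sum_range_succ, ih, Finset.sum_range_succ _ (m + 1),
      Finset.sum_range_succ (fun i => c i • f^[i] v) (m + 1)]
    have : (semilinearCoord p a c (m + 1)).eval e =
      (semilinearCoord p a c m).eval e ^ p + c (m + 1) * e := by simp [semilinearCoord]
    simp only [this]
    module

theorem exists_iterate_mem_span [FiniteDimensional F V] (f : V → V) (C : Submodule F V) (v : V) :
    ∃ n, f^[n] v ∈ C ⊔ Submodule.span F ((fun i => f^[i] v) '' (Finset.range n : Set ℕ)) := by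
  let g : ℕ →o Submodule F V :=
    ⟨fun n => C ⊔ Submodule.span F ((fun i => f^[i] v) '' (Finset.range n : Set ℕ)), by
      intro m n hmn
      refine sup_le_sup_left (Submodule.span_mono (Set.image_mono ?_)) _
      exact_mod_cast Finset.range_mono hmn⟩
  obtain ⟨n, hn⟩ := monotone_stabilizes_iff_noetherian.2 (inferInstance : IsNoetherian F V) g
  refine ⟨n, ?_⟩
  change _ ∈ g n
  rw [hn (n + 1) (Nat.le_succ n)]
  refine Submodule.mem_sup_right (Submodule.subset_span ⟨n, by simp, rfl⟩)

theorem exists_relation {C : Submodule F V} {v : V} {n : ℕ}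
    (h : f^[n] v ∈ C ⊔ Submodule.span F ((fun i => f^[i] v) '' (Finset.range n : Set ℕ))) :
    ∃ c : ℕ → F, f^[n] v - ∑ i ∈ Finset.range n, c i • f^[i] v ∈ C := by
  obtain ⟨u, hu, w, hw, huw⟩ := Submodule.mem_sup.1 h
  obtain ⟨c, hc⟩ := (Submodule.mem_span_image_finset_iff_exists_fun F).1 hw
  refine ⟨fun i => if hi : i ∈ Finset.range n then c ⟨i, hi⟩ else 0, ?_⟩
  rw [← Finset.sum_attach]
  simpa [← huw, ← hc] using hu

/-- Lang's theorem for `p`-semilinear maps over an algebraically closed field. -/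
theorem exists_sub_eq [IsAlgClosed F] [FiniteDimensional F V] (hf : IsSemilinearOn F p f B)
    {v : V} (hv : v ∈ B) : ∃ z ∈ B, f z - z = v := by
  obtain ⟨n, hn⟩ := exists_iterate_mem_span f (⊥ : Submodule F V) v
  obtain ⟨c, hc⟩ := exists_relation hn
  rw [Submodule.mem_bot, sub_eq_zero] at hc
  rcases n with _ | m
  · refine ⟨0, B.zero_mem, ?_⟩
    simp at hc
    simp [hc, hf.map_zero]
  · obtain ⟨e, he⟩ := exists_root_semilinearCoord (p := p) (-1 : F) c m
    refine ⟨∑ i ∈ Finset.range (m + 1), (semilinearCoord p (-1) c i).eval e • f^[i] v,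
      B.sum_mem fun i _ => B.smul_mem _ (hf.iterate_mem hv i), ?_⟩
    rw [hf.map_coord hv, he, hc]
    module

/-- A `p`-semilinear map has an eigenvector, modulo any proper subspace `C`. -/
theorem exists_notMem [IsAlgClosed F] [FiniteDimensional F V] (hf : IsSemilinearOn F p f B)
    {C : Submodule F V} {v : V} (hv : v ∈ B) (hvC : v ∉ C) :
    ∃ z ∈ B, z ∉ C ∧ (f z ∈ C ∨ f z - z ∈ C) := by
  classical
  have hex := exists_iterate_mem_span f C v
  have hmin := fun m => Nat.find_min hex (m := m)
  obtain ⟨c, hc⟩ := exists_relation (Nat.find_spec hex)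
  generalize Nat.find hex = n at *
  rcases n with _ | m
  · simp at hc
    exact absurd hc hvC
  have hm := hmin m (Nat.lt_succ_self m)
  -- If the polynomial vanishes, so do all `c i`, and `f^[m] v` is mapped into `C`; otherwise a
  -- nonzero root yields a vector fixed modulo `C`.
  by_cases h0 : semilinearCoord p 0 c m = 0
  · have hc0 := coeff_eq_zero_of_semilinearCoord_eq_zero c m h0
    rw [Finset.sum_eq_zero, sub_zero, Function.iterate_succ_apply'] at hc
    · exact ⟨_, hf.iterate_mem hv m, fun h => hm (Submodule.mem_sup_left h), Or.inl hc⟩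
    · intro i hi
      rw [hc0 i (by simpa [Nat.lt_succ_iff] using hi), zero_smul]
  · obtain ⟨e, he0, he⟩ := exists_ne_zero_root_semilinearCoord c m h0
    refine ⟨∑ i ∈ Finset.range (m + 1), (semilinearCoord p 0 c i).eval e • f^[i] v,
      B.sum_mem fun i _ => B.smul_mem _ (hf.iterate_mem hv i), ?_, Or.inr ?_⟩
    · intro hz
      -- The leading coordinate of `z` is nonzero, so `z ∈ C` would express `f^[m] v` by lower
      -- iterates modulo `C`, against the minimality of `m + 1`.
      have hd : (semilinearCoord p 0 c m).eval e ≠ 0 := by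
        intro h
        rw [h, zero_pow (Fact.out : p.Prime).ne_zero] at he
        exact he0 he.symm
      apply hm
      rw [Finset.sum_range_succ] at hz
      rw [← Submodule.smul_mem_iff _ hd]
      have h2 : ∑ i ∈ Finset.range m, (semilinearCoord p 0 c i).eval e • f^[i] v ∈
          Submodule.span F ((fun i => f^[i] v) '' (Finset.range m : Set ℕ)) :=
        Submodule.sum_mem _ fun i hi => Submodule.smul_mem _ _
          (Submodule.subset_span ⟨i, by simpa using hi, rfl⟩)
      have := Submodule.sub_mem _ (Submodule.mem_sup_left (S := C) hz)
        (Submodule.mem_sup_right (S := C) h2)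
      simpa using this
    · rw [hf.map_coord hv, he]
      convert C.smul_mem e hc using 1
      module

end IsSemilinearOn

end Semilinear

/-! ### Computing with the `p`-mapping -/

section Restricted

variable {F : Type*} {p : ℕ} {L : Type*} [Field F] [Fact p.Prime] [CharP F p]
  [LieRing L] [LieAlgebra F L] [RestrictedLieAlgebra F p L]

local notation "φ" => RestrictedLieAlgebra.pMap F p

namespace RestrictedLieAlgebra

theorem jacobsonCoeff_mem (K : LieSubalgebra F L) {a b : L} (ha : a ∈ K) (hb : b ∈ K) (n : ℕ) :
    ∀ k, jacobsonCoeff a b n k ∈ K := by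
  induction n with
  | zero =>
    rintro (_ | k)
    · simpa [jacobsonCoeff] using ha
    · simp [jacobsonCoeff]
  | succ n ih =>
    rintro (_ | k)
    · exact K.lie_mem hb (ih 0)
    · exact K.add_mem (K.lie_mem ha (ih k)) (K.lie_mem hb (ih (k + 1)))

theorem pMap_add_mem (K : LieSubalgebra F L) {a b : L} (ha : a ∈ K) (hb : b ∈ K)
    (ha' : φ a ∈ K) (hb' : φ b ∈ K) : φ (a + b) ∈ K := by
  rw [pMap_add]
  refine K.add_mem (K.add_mem ha' hb') (K.toSubmodule.sum_mem fun i _ => ?_)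
  exact K.smul_mem _ (jacobsonCoeff_mem K ha hb _ _)

variable (F p) in
theorem pMap_zero : φ (0 : L) = 0 := by
  have := pMap_smul (F := F) (p := p) 0 (0 : L)
  simpa [(Fact.out : p.Prime).ne_zero] using this

theorem pMap_mem_of_span (K : LieSubalgebra F L) (s : Set L)
    (hs : K.toSubmodule = Submodule.span F s)
    (h : ∀ x ∈ s, φ x ∈ K) {x : L} (hx : x ∈ K) : φ x ∈ K := by
  have hx' : x ∈ Submodule.span F s := hs ▸ hx
  have hK : ∀ {y}, y ∈ Submodule.span F s → y ∈ K := fun hy => by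
    rw [← hs] at hy; exact hy
  clear hx
  induction hx' using Submodule.span_induction with
  | mem x hx => exact h x hx
  | zero => rw [pMap_zero]; exact K.zero_mem
  | add x y hx hy ihx ihy =>
    exact pMap_add_mem K (hK hx) (hK hy) ihx ihy
  | smul c x hx ih => rw [pMap_smul]; exact K.smul_mem _ ih

theorem pMap_add_of_lie_eq_zero {x y : L} (h : ⁅x, y⁆ = 0) : φ (x + y) = φ x + φ y := by
  have h' : ⁅y, x⁆ = 0 := by rw [← lie_skew, h, neg_zero]
  have key : ∀ n k, jacobsonCoeff x y (n + 1) k = 0 := by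
    intro n
    induction n with
    | zero =>
      rintro (_ | _ | k) <;> simp [jacobsonCoeff, h']
    | succ n ih =>
      rintro (_ | k)
      · rw [jacobsonCoeff, ih, lie_zero]
      · rw [jacobsonCoeff, ih, ih, lie_zero, lie_zero, add_zero]
  rw [pMap_add, Finset.sum_eq_zero, add_zero]
  intro i _
  have : p - 1 = p - 2 + 1 := by have := (Fact.out : p.Prime).two_le; omega
  rw [jacobsonS, this, key, smul_zero]

/-- Here `(ad (t X + x)) ^ (n + 1) (t) = -x X ^ n`, so only `s_{p-1}` survives, and it equals `x`
because `p - 1 = -1` in `F`. -/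
theorem pMap_add_of_lie_eq {t x : L} (h : ⁅t, x⁆ = x) : φ (t + x) = φ t + φ x + x := by
  have h' : ⁅x, t⁆ = -x := by rw [← lie_skew, h]
  have key : ∀ n k, jacobsonCoeff t x (n + 1) k = if k = n then -x else 0 := by
    intro n
    induction n with
    | zero =>
      rintro (_ | _ | k) <;> simp [jacobsonCoeff, h']
    | succ n ih =>
      rintro (_ | k)
      · rw [jacobsonCoeff, ih, if_neg (Nat.succ_ne_zero n).symm]
        split_ifs <;> simp
      · rw [jacobsonCoeff, ih, ih]
        split_ifs <;> first | omega | simp [h]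
  have hp := (Fact.out : p.Prime).two_le
  have hp1 : p - 1 = p - 2 + 1 := by omega
  rw [pMap_add, Finset.sum_eq_single (p - 1)]
  · rw [jacobsonS, hp1, key, if_pos (by omega), ← hp1]
    have : ((p - 1 : ℕ) : F) = -1 := by
      rw [Nat.cast_sub (by omega), CharP.cast_eq_zero]; simp
    rw [this]
    simp [inv_neg]
  · intro i hi hne
    rw [Finset.mem_Icc] at hi
    rw [jacobsonS, hp1, key, if_neg (by omega), smul_zero]
  · intro h
    simp at h
    omega

theorem lie_pMap (x y : L) : ⁅φ x, y⁆ = (LieAlgebra.ad F L x ^ p) y := by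
  rw [← ad_pMap, LieAlgebra.ad_apply]

theorem ad_iterate_pMap (x : L) (i : ℕ) :
    LieAlgebra.ad F L ((φ)^[i] x) = LieAlgebra.ad F L x ^ p ^ i := by
  induction i with
  | zero => simp
  | succ i ih => rw [Function.iterate_succ_apply', ad_pMap, ih, ← pow_mul, pow_succ]

theorem ad_pow_eq_zero {x y : L} (h : ⁅x, y⁆ = 0) {n : ℕ} (hn : n ≠ 0) :
    (LieAlgebra.ad F L x ^ n) y = 0 := by
  obtain ⟨m, rfl⟩ := Nat.exists_eq_succ_of_ne_zero hn
  rw [pow_succ, Module.End.mul_apply, LieAlgebra.ad_apply, h, map_zero]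

theorem ad_pow_eq_smul {x y : L} {c : F} (h : ⁅x, y⁆ = c • y) (n : ℕ) :
    (LieAlgebra.ad F L x ^ n) y = c ^ n • y := by
  induction n with
  | zero => simp
  | succ n ih =>
    rw [pow_succ', Module.End.mul_apply, ih, map_smul, LieAlgebra.ad_apply, h, smul_smul, pow_succ]

theorem lie_pMap_eq_zero {x y : L} (h : ⁅x, y⁆ = 0) : ⁅φ x, y⁆ = 0 := by
  rw [lie_pMap, ad_pow_eq_zero h (Fact.out : p.Prime).ne_zero]

theorem lie_iterate_pMap_eq_zero {x y : L} (h : ⁅x, y⁆ = 0) (i : ℕ) : ⁅(φ)^[i] x, y⁆ = 0 := by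
  induction i with
  | zero => exact h
  | succ i ih => rw [Function.iterate_succ_apply']; exact lie_pMap_eq_zero ih

theorem ad_pow_mem {U : Submodule F L} {x : L} (h : ∀ u ∈ U, ⁅x, u⁆ ∈ U) {u : L} (hu : u ∈ U)
    (n : ℕ) : (LieAlgebra.ad F L x ^ n) u ∈ U := by
  induction n with
  | zero => simpa
  | succ n ih => rw [pow_succ', Module.End.mul_apply]; exact h _ ih

end RestrictedLieAlgebra

open RestrictedLieAlgebra

/-! ### Restricted subalgebras: generators and the `p`-span of one element -/

namespace RestrictedSubalgebra

theorem pMap_mem (S : RestrictedSubalgebra F p L) {x : L} (hx : x ∈ S) : φ x ∈ S := S.pMap_mem' hx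

theorem lie_mem (S : RestrictedSubalgebra F p L) {x y : L} (hx : x ∈ S) (hy : y ∈ S) :
    ⁅x, y⁆ ∈ S := S.lie_mem' hx hy

theorem mem_toSubmodule {S : RestrictedSubalgebra F p L} {x : L} : x ∈ S.toSubmodule ↔ x ∈ S :=
  Iff.rfl

theorem toSubmodule_strictMono :
    StrictMono (fun S : RestrictedSubalgebra F p L => S.toSubmodule) := fun _ _ h => h

theorem mem_inf {S T : RestrictedSubalgebra F p L} {x : L} : x ∈ S ⊓ T ↔ x ∈ S ∧ x ∈ T := by
  refine ⟨fun h => ⟨inf_le_left (a := S) h, inf_le_right (a := S) h⟩, fun h => ?_⟩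
  have hx : x ∈ sInf {S, T} := by
    rintro U (rfl | rfl)
    · exact h.1
    · exact h.2
  rwa [sInf_pair] at hx

/-- The restricted subalgebra spanned by a set that is closed under the bracket and the `p`-mapping
up to linear combinations. -/
def ofSpan (s : Set L) (hl : ∀ x ∈ s, ∀ y ∈ s, ⁅x, y⁆ ∈ Submodule.span F s)
    (hp : ∀ x ∈ s, φ x ∈ Submodule.span F s) : RestrictedSubalgebra F p L :=
  let K : LieSubalgebra F L :=
    { Submodule.span F s with
      lie_mem' := by
        intro x y hx hy
        change x ∈ Submodule.span F s at hx
        change y ∈ Submodule.span F s at hy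
        change ⁅x, y⁆ ∈ Submodule.span F s
        induction hx using Submodule.span_induction with
        | mem x hx =>
          induction hy using Submodule.span_induction with
          | mem y hy => exact hl x hx y hy
          | zero => simp
          | add y z _ _ ihy ihz => rw [lie_add]; exact Submodule.add_mem _ ihy ihz
          | smul c y _ ih => rw [lie_smul]; exact Submodule.smul_mem _ _ ih
        | zero => simp
        | add y z _ _ ihy ihz => rw [add_lie]; exact Submodule.add_mem _ ihy ihz
        | smul c y _ ih => rw [smul_lie]; exact Submodule.smul_mem _ _ ih }
  { K with pMap_mem' := fun hx => pMap_mem_of_span K s rfl hp hx }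

theorem mem_ofSpan {s : Set L} {hl} {hp} {x : L} :
    x ∈ ofSpan (F := F) (p := p) s hl hp ↔ x ∈ Submodule.span F s := Iff.rfl

theorem subset_ofSpan {s : Set L} {hl} {hp} {x : L} (hx : x ∈ s) :
    x ∈ ofSpan (F := F) (p := p) s hl hp := Submodule.subset_span hx

theorem ofSpan_le {s : Set L} {hl} {hp} {S : RestrictedSubalgebra F p L} :
    ofSpan (F := F) (p := p) s hl hp ≤ S ↔ ∀ x ∈ s, x ∈ S :=
  Submodule.span_le (p := S.toSubmodule)

theorem mem_bot {x : L} : x ∈ (⊥ : RestrictedSubalgebra F p L) ↔ x = 0 := by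
  refine ⟨fun h => ?_, fun h => h ▸ (⊥ : RestrictedSubalgebra F p L).zero_mem⟩
  have : (⊥ : RestrictedSubalgebra F p L) ≤ ofSpan ∅ (by simp) (by simp) := bot_le
  simpa [mem_ofSpan] using this h

theorem isSemilinearOn (S : RestrictedSubalgebra F p L) (h : ∀ x ∈ S, ∀ y ∈ S, ⁅x, y⁆ = 0) :
    IsSemilinearOn F p φ S.toSubmodule where
  mem _ hx := S.pMap_mem hx
  add x hx y hy := pMap_add_of_lie_eq_zero (h x hx y hy)
  smul c x _ := pMap_smul c x

variable (F p) in
/-- The restricted subalgebra generated by `x`, which is spanned by the iterated `p`-powers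
of `x`. -/
def pSpan (x : L) : RestrictedSubalgebra F p L :=
  ofSpan (Set.range fun i => (φ)^[i] x)
    (by
      rintro _ ⟨i, rfl⟩ _ ⟨j, rfl⟩
      have : ⁅(φ)^[i] x, (φ)^[j] x⁆ = 0 := by
        apply lie_iterate_pMap_eq_zero
        rw [← lie_skew, lie_iterate_pMap_eq_zero (lie_self x), neg_zero]
      rw [this]
      exact Submodule.zero_mem _)
    (by
      rintro _ ⟨i, rfl⟩
      refine Submodule.subset_span ⟨i + 1, ?_⟩
      simp only [Function.iterate_succ_apply'])

theorem self_mem_pSpan (x : L) : x ∈ pSpan F p x := subset_ofSpan ⟨0, rfl⟩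

theorem pSpan_le {x : L} {S : RestrictedSubalgebra F p L} : pSpan F p x ≤ S ↔ x ∈ S := by
  refine ⟨fun h => h (self_mem_pSpan x), fun h => ofSpan_le.2 ?_⟩
  rintro _ ⟨i, rfl⟩
  induction i with
  | zero => exact h
  | succ i ih => simp only [Function.iterate_succ_apply']; exact S.pMap_mem ih

theorem pSpan_induction {x : L} {P : L → Prop} (h : ∀ i, P ((φ)^[i] x)) (h0 : P 0)
    (hadd : ∀ a b, P a → P b → P (a + b)) (hsmul : ∀ (c : F) a, P a → P (c • a))
    {b : L} (hb : b ∈ pSpan F p x) : P b := by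
  change b ∈ Submodule.span F _ at hb
  induction hb using Submodule.span_induction with
  | mem y hy => obtain ⟨i, rfl⟩ := hy; exact h i
  | zero => exact h0
  | add a b _ _ ha hb => exact hadd _ _ ha hb
  | smul c a _ ha => exact hsmul _ _ ha

theorem lie_eq_zero_of_mem_pSpan {x y b : L} (h : ⁅x, y⁆ = 0) (hb : b ∈ pSpan F p x) :
    ⁅b, y⁆ = 0 :=
  pSpan_induction (P := fun b => ⁅b, y⁆ = 0) (fun i => lie_iterate_pMap_eq_zero h i) (zero_lie y)
    (fun a b ha hb => by rw [add_lie, ha, hb, add_zero])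
    (fun c a ha => by rw [smul_lie, ha, smul_zero]) hb

theorem pSpan_comm {x b c : L} (hb : b ∈ pSpan F p x) (hc : c ∈ pSpan F p x) : ⁅b, c⁆ = 0 := by
  refine lie_eq_zero_of_mem_pSpan ?_ hb
  rw [← lie_skew, lie_eq_zero_of_mem_pSpan (lie_self x) hc, neg_zero]

theorem lie_mem_of_mem_pSpan {x b : L} {U : Submodule F L} (h : ∀ u ∈ U, ⁅x, u⁆ ∈ U)
    (hb : b ∈ pSpan F p x) {u : L} (hu : u ∈ U) : ⁅b, u⁆ ∈ U :=
  pSpan_induction (P := fun b => ⁅b, u⁆ ∈ U)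
    (fun i => by
      rw [← LieAlgebra.ad_apply (R := F), ad_iterate_pMap]
      exact ad_pow_mem h hu _)
    (by simp) (fun a b ha hb => by rw [add_lie]; exact U.add_mem ha hb)
    (fun c a ha => by rw [smul_lie]; exact U.smul_mem _ ha) hb

theorem isSemilinearOn_pSpan (x : L) : IsSemilinearOn F p φ (pSpan F p x).toSubmodule :=
  isSemilinearOn _ fun _ hx _ hy => pSpan_comm hx hy

instance [FiniteDimensional F L] : WellFoundedGT (RestrictedSubalgebra F p L) :=
  toSubmodule_strictMono.wellFoundedGT

/-! ### Quasi-ideals and the modular law -/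

/-- The sum of two restricted subalgebras, the first of which is a quasi-ideal. -/
theorem IsQuasiIdeal.toSubmodule_sup {S : RestrictedSubalgebra F p L} (hS : S.IsQuasiIdeal)
    (T : RestrictedSubalgebra F p L) : (S ⊔ T).toSubmodule = S.toSubmodule ⊔ T.toSubmodule := by
  have hspan : Submodule.span F ((S.toSubmodule : Set L) ∪ T.toSubmodule) =
      S.toSubmodule ⊔ T.toSubmodule := by
    rw [Submodule.span_union, Submodule.span_eq, Submodule.span_eq]
  refine le_antisymm ?_ (sup_le (le_sup_left (a := S)) (le_sup_right (a := S)))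
  have hle : S ⊔ T ≤ ofSpan ((S.toSubmodule : Set L) ∪ T.toSubmodule) ?_ ?_ :=
    sup_le (fun x hx => subset_ofSpan (Or.inl hx)) (fun x hx => subset_ofSpan (Or.inr hx))
  · intro x hx
    rw [← hspan]
    exact hle hx
  · rw [hspan]
    rintro x (hx | hx) y (hy | hy)
    · exact Submodule.mem_sup_left (S.lie_mem hx hy)
    · exact hS T x hx y hy
    · rw [← lie_skew]
      exact Submodule.neg_mem _ (hS T y hy x hx)
    · exact Submodule.mem_sup_right (T.lie_mem hx hy)
  · rw [hspan]
    rintro x (hx | hx)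
    · exact Submodule.mem_sup_left (S.pMap_mem hx)
    · exact Submodule.mem_sup_right (T.pMap_mem hx)

theorem isModularLattice_of_isQuasiIdeal (h : ∀ S : RestrictedSubalgebra F p L, S.IsQuasiIdeal) :
    IsModularLattice (RestrictedSubalgebra F p L) where
  sup_inf_le_assoc_of_le {X} Y {Z} hXZ := by
    intro u hu
    obtain ⟨hu1, hu2⟩ := mem_inf.1 hu
    rw [← mem_toSubmodule, (h X).toSubmodule_sup] at hu1
    obtain ⟨x, hx, y, hy, rfl⟩ := Submodule.mem_sup.1 hu1
    have hyZ : y ∈ Z := by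
      have := Z.toSubmodule.sub_mem hu2 (hXZ hx)
      rwa [add_sub_cancel_left] at this
    exact (X ⊔ Y ⊓ Z).toSubmodule.add_mem (le_sup_left (a := X) hx)
      (le_sup_right (a := X) (mem_inf.2 ⟨hy, hyZ⟩))

end RestrictedSubalgebra

end Restricted

/-! ### Diagonalizability and the toral criterion for nilpotency -/

/-- `X ^ p - X` is separable, so `f` is semisimple and generalized eigenspaces are eigenspaces. -/
theorem Module.End.iSup_eigenspace_eq_top_of_pow_eq_self {F V : Type*} [Field F] [IsAlgClosed F]
    [AddCommGroup V] [Module F V] [FiniteDimensional F V] {p : ℕ} [Fact p.Prime] [CharP F p]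
    {f : Module.End F V} (h : f ^ p = f) : ⨆ μ, f.eigenspace μ = ⊤ := by
  have hs : f.IsSemisimple := by
    refine Module.End.isSemisimple_of_squarefree_aeval_eq_zero
      (galois_poly_separable p p dvd_rfl :
        (Polynomial.X ^ p - Polynomial.X : Polynomial F).Separable).squarefree ?_
    simp [h]
  rw [← Module.End.iSup_maxGenEigenspace_eq_top f]
  exact iSup_congr fun μ => (hs.isFinitelySemisimple.maxGenEigenspace_eq_eigenspace μ).symm

namespace IsSemilinearOn

variable {F V : Type*} [Field F] [AddCommGroup V] [Module F V] {p : ℕ} [Fact p.Prime] [CharP F p]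
  {f : V → V}
  {B : Submodule F V}

theorem map_sub (hf : IsSemilinearOn F p f B) {x y : V} (hx : x ∈ B) (hy : y ∈ B) :
    f (x - y) = f x - f y := by
  rw [eq_sub_iff_add_eq, ← hf.add _ (B.sub_mem hx hy) _ hy, sub_add_cancel]

theorem iterate_map_sub (hf : IsSemilinearOn F p f B) {x y : V} (hx : x ∈ B) (hy : y ∈ B)
    (n : ℕ) : f^[n] (x - y) = f^[n] x - f^[n] y := by
  induction n with
  | zero => rfl
  | succ n ih =>
    rw [Function.iterate_succ_apply', ih, hf.map_sub (hf.iterate_mem hx n) (hf.iterate_mem hy n),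
      ← Function.iterate_succ_apply' f, ← Function.iterate_succ_apply' f]

end IsSemilinearOn

section Restricted

variable {F : Type*} {p : ℕ} {L : Type*} [Field F] [Fact p.Prime] [CharP F p]
  [LieRing L] [LieAlgebra F L] [RestrictedLieAlgebra F p L]

local notation "φ" => RestrictedLieAlgebra.pMap F p

open RestrictedLieAlgebra

namespace RestrictedSubalgebra

theorem ad_commute {x y : L} (h : ⁅x, y⁆ = 0) :
    Commute (LieAlgebra.ad F L x) (LieAlgebra.ad F L y) := by
  ext z
  simp [leibniz_lie x y, h]

/-- An element whose associated toral elements are central is `ad`-nilpotent. -/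
theorem isNilpotent_ad_of_toral [IsAlgClosed F] [FiniteDimensional F L] (x : L)
    (h : ∀ t ∈ pSpan F p x, φ t = t → LieAlgebra.ad F L t = 0) :
    IsNilpotent (LieAlgebra.ad F L x) := by
  -- The `ad`-nilpotent elements of `⟨x⟩_p` form a subspace because `⟨x⟩_p` is commutative. If `x`
  -- is outside it, some `z` outside it is killed or fixed modulo it.
  let C : Submodule F L :=
    { carrier := {b | b ∈ pSpan F p x ∧ IsNilpotent (LieAlgebra.ad F L b)}
      add_mem' := by
        rintro a b ⟨ha, ha'⟩ ⟨hb, hb'⟩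
        refine ⟨(pSpan F p x).add_mem ha hb, ?_⟩
        rw [map_add]
        exact (ad_commute (pSpan_comm ha hb)).isNilpotent_add ha' hb'
      zero_mem' := ⟨(pSpan F p x).zero_mem, by simp⟩
      smul_mem' := by
        rintro c a ⟨ha, ha'⟩
        refine ⟨(pSpan F p x).smul_mem c ha, ?_⟩
        rw [map_smul]
        exact ha'.smul c }
  have hf := isSemilinearOn_pSpan (F := F) (p := p) x
  by_contra hx
  obtain ⟨z, hz, hzC, hz'⟩ := hf.exists_notMem (C := C) (self_mem_pSpan x) fun h => hx h.2
  apply hzC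
  refine ⟨hz, ?_⟩
  rcases hz' with hz' | hz'
  · have := hz'.2
    rw [ad_pMap] at this
    exact this.of_pow
  · obtain ⟨n, hn⟩ := hz'.2
    -- A high enough `p`-power makes the error `φ w - w` act as zero. Solving `φ d - d = φ w - w`
    -- inside the `p`-span of that error gives a `d` acting as zero, and then `w - d` is toral.
    let w := (φ)^[n] z
    have hw : w ∈ pSpan F p x := hf.iterate_mem hz n
    have hwk : φ w - w = (φ)^[n] (φ z - z) := by
      rw [hf.iterate_map_sub (hf.mem _ hz) hz, ← Function.iterate_succ_apply,
        Function.iterate_succ_apply']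
    have hk : φ w - w ∈ pSpan F p x := (pSpan F p x).toSubmodule.sub_mem (hf.mem _ hw) hw
    have hadk : LieAlgebra.ad F L (φ w - w) = 0 := by
      rw [hwk, ad_iterate_pMap]
      exact pow_eq_zero_of_le (Nat.lt_pow_self (Fact.out : p.Prime).one_lt).le hn
    obtain ⟨d, hd, hdk⟩ := (isSemilinearOn_pSpan (F := F) (p := p) (φ w - w)).exists_sub_eq
      (self_mem_pSpan _)
    have hdx : d ∈ pSpan F p x := pSpan_le.2 hk hd
    have hadd : LieAlgebra.ad F L d = 0 := by
      ext y
      exact lie_eq_zero_of_mem_pSpan (by simpa using LinearMap.congr_fun hadk y) hd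
    have ht : φ (w - d) = w - d := by
      rw [hf.map_sub hw hdx, sub_eq_sub_iff_sub_eq_sub]
      exact hdk.symm
    have := h _ ((pSpan F p x).toSubmodule.sub_mem hw hdx) ht
    rw [map_sub, hadd, sub_zero, ad_iterate_pMap] at this
    exact ⟨_, this⟩

/-! ### Restricted subalgebras spanned by one or two elements -/

/-- The line spanned by an eigenvector of the `p`-mapping. -/
def line (a : L) (h : φ a ∈ Submodule.span F {a}) : RestrictedSubalgebra F p L :=
  ofSpan {a} (by simp) (by simpa using h)

theorem self_mem_line {a : L} {h : φ a ∈ Submodule.span F {a}} : a ∈ line a h :=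
  Submodule.mem_span_singleton_self a

theorem line_le {a : L} {h : φ a ∈ Submodule.span F {a}} {S : RestrictedSubalgebra F p L} :
    line a h ≤ S ↔ a ∈ S := by
  rw [line, ofSpan_le]; simp

theorem eq_bot_of_lt_line {a : L} {h : φ a ∈ Submodule.span F {a}} {S : RestrictedSubalgebra F p L}
    (hS : S < line a h) : S = ⊥ := by
  refine eq_bot_iff.2 fun x hx => mem_bot.2 ?_
  by_contra hx0
  obtain ⟨c, rfl⟩ := Submodule.mem_span_singleton.1 (hS.le hx)
  have hc : c ≠ 0 := by rintro rfl; simp at hx0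
  exact hS.not_ge (line_le.2 ((Submodule.smul_mem_iff S.toSubmodule hc).1 hx))

theorem bot_covBy_line {a : L} {h : φ a ∈ Submodule.span F {a}} (ha : a ≠ 0) : ⊥ ⋖ line a h :=
  ⟨bot_lt_iff_ne_bot.2 fun h0 => ha (mem_bot.1 (h0 ▸ self_mem_line)),
    fun _ h1 h2 => h1.ne' (eq_bot_of_lt_line h2)⟩

theorem line_inf_line {a b : L} {ha : φ a ∈ Submodule.span F {a}} {hb : φ b ∈ Submodule.span F {b}}
    (h : a ∉ Submodule.span F {b}) : line a ha ⊓ line b hb = ⊥ := by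
  refine eq_bot_of_lt_line (h := ha) (lt_of_le_not_ge inf_le_left fun hle => h ?_)
  exact (mem_inf.1 (hle self_mem_line)).2

theorem line_covBy_sup [IsUpperModularLattice (RestrictedSubalgebra F p L)] {a b : L}
    {ha : φ a ∈ Submodule.span F {a}} {hb : φ b ∈ Submodule.span F {b}}
    (h : a ∉ Submodule.span F {b}) : line b hb ⋖ line a ha ⊔ line b hb := by
  apply covBy_sup_of_inf_covBy_left
  rw [line_inf_line h]
  exact bot_covBy_line (by rintro rfl; simp at h)

theorem notMem_span_comm {a b : L} (hb : b ≠ 0) (h : a ∉ Submodule.span F {b}) :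
    b ∉ Submodule.span F {a} := by
  rw [Submodule.mem_span_singleton] at h ⊢
  rintro ⟨c, rfl⟩
  have hc : c ≠ 0 := by rintro rfl; simp at hb
  exact h ⟨c⁻¹, by rw [smul_smul, inv_mul_cancel₀ hc, one_smul]⟩

/-- Exchange: two distinct lines in `M`, one of them maximal in `M`, have join `M`, so
semimodularity makes the other maximal too. -/
theorem line_covBy_of_mem [IsUpperModularLattice (RestrictedSubalgebra F p L)] {a c : L}
    {ha : φ a ∈ Submodule.span F {a}} {M : RestrictedSubalgebra F p L} (haM : line a ha ⋖ M)
    (ha0 : a ≠ 0) (hc0 : c ≠ 0) (hc : φ c ∈ Submodule.span F {c}) (hcM : c ∈ M) :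
    line c hc ⋖ M := by
  by_cases h : c ∈ Submodule.span F {a}
  · convert haM using 1
    have hle : line c hc ≤ line a ha := line_le.2 h
    refine hle.eq_of_not_lt fun hlt => ?_
    exact hc0 (mem_bot.1 (eq_bot_of_lt_line hlt ▸ self_mem_line))
  · have h1 : line a ha ⋖ line c hc ⊔ line a ha := line_covBy_sup h
    have h2 : line c hc ⊔ line a ha = M :=
      (haM.eq_or_eq h1.le (sup_le (line_le.2 hcM) haM.le)).resolve_left h1.ne'
    rw [← h2, sup_comm]
    exact line_covBy_sup (notMem_span_comm ha0 h)

theorem le_span_pair_of_covBy {a b : L} {ha : φ a ∈ Submodule.span F {a}}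
    {M : RestrictedSubalgebra F p L} (haM : line a ha ⋖ M) (hbM : b ∈ M)
    (hab : b ∉ Submodule.span F {a}) (hl : ⁅a, b⁆ ∈ Submodule.span F {a, b})
    (hb : φ b ∈ Submodule.span F {a, b}) : M.toSubmodule ≤ Submodule.span F {a, b} := by
  let P : RestrictedSubalgebra F p L := ofSpan {a, b}
    (by
      rintro x (rfl | rfl) y (rfl | rfl)
      · simp
      · exact hl
      · rw [← lie_skew]; exact Submodule.neg_mem _ hl
      · simp)
    (by
      rintro x (rfl | rfl)
      · exact Submodule.span_mono (by simp) ha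
      · exact hb)
  have hP : P ≤ M := by
    refine ofSpan_le.2 ?_
    rintro x (rfl | rfl)
    · exact haM.le self_mem_line
    · exact hbM
  have haP : line a ha ≤ P := line_le.2 (subset_ofSpan (by simp))
  rcases haM.eq_or_eq haP hP with h | h
  · exact absurd (h ▸ subset_ofSpan (by simp) : b ∈ line a ha) hab
  · rw [← h]; exact le_rfl

/-! ### Toral elements -/

theorem ad_pow_of_toral {t : L} (ht : φ t = t) : LieAlgebra.ad F L t ^ p = LieAlgebra.ad F L t := by
  rw [← ad_pMap, ht]

/-- `ad t` is diagonalizable on every invariant subspace when `t` is toral. -/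
theorem exists_eigenvector_of_toral [IsAlgClosed F] [FiniteDimensional F L] {t : L} (ht : φ t = t)
    {U : Submodule F L} (hU : ∀ u ∈ U, ⁅t, u⁆ ∈ U) {u : L} (hu : u ∈ U) (htu : ⁅t, u⁆ ≠ 0) :
    ∃ x ∈ U, ∃ μ : F, x ≠ 0 ∧ μ ≠ 0 ∧ ⁅t, x⁆ = μ • x := by
  let T : Module.End F U := (LieAlgebra.ad F L t).restrict hU
  have hT : T ^ p = T := by
    refine (Module.End.pow_restrict p hU).trans ?_
    ext x
    exact LinearMap.congr_fun (ad_pow_of_toral ht) (x : L)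
  have htop := Module.End.iSup_eigenspace_eq_top_of_pow_eq_self hT
  by_contra! hcon
  have hle : ⨆ μ, T.eigenspace μ ≤ LinearMap.ker T := by
    refine iSup_le fun μ x hx => ?_
    rw [Module.End.mem_eigenspace_iff] at hx
    by_cases hμ : μ = 0
    · simpa [hμ] using hx
    · by_cases hx0 : x = 0
      · simp [hx0]
      · exact absurd (congrArg Subtype.val hx) (hcon x x.2 μ (by simpa using hx0) hμ)
  rw [htop] at hle
  have := hle (Submodule.mem_top (x := (⟨u, hu⟩ : U)))
  exact htu (congrArg Subtype.val (LinearMap.mem_ker.1 this))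

/-- `[φ x, t] = (ad x) ^ p t`, and already `(ad x) ^ 2 t` is a multiple of `[x, x]`. -/
theorem lie_pMap_eq_zero_of_eigenvector {t x : L} {μ : F} (h : ⁅t, x⁆ = μ • x) : ⁅t, φ x⁆ = 0 := by
  have hp := (Fact.out : p.Prime).two_le
  obtain ⟨m, hm⟩ : ∃ m, p = m + 1 + 1 := ⟨p - 2, by omega⟩
  rw [← lie_skew, lie_pMap, hm, pow_succ, Module.End.mul_apply, LieAlgebra.ad_apply, ← lie_skew, h,
    map_neg, map_smul, ad_pow_eq_zero (lie_self x) (Nat.succ_ne_zero m)]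
  simp

/-- If the centralizer of `t` in `M` exceeds `F t`, it contains a vector outside `F t` killed or
fixed modulo `F t`. Otherwise `ad t` has an eigenvector `x` of nonzero weight; `φ x` centralizes
`t`, so is a multiple of `t`, and it commutes with `x`, so is zero. Either way `t` and the new
vector span a restricted subalgebra, which must be `M`. -/
theorem exists_le_span_pair_of_toral [IsAlgClosed F] [FiniteDimensional F L] {t : L} (ht : φ t = t)
    {ht' : φ t ∈ Submodule.span F {t}} {M : RestrictedSubalgebra F p L} (htM : line t ht' ⋖ M) :
    ∃ (x : L) (μ : F), ⁅t, x⁆ = μ • x ∧ M.toSubmodule ≤ Submodule.span F {t, x} := by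
  have htM' : t ∈ M := htM.le self_mem_line
  by_cases hc : ∃ y ∈ M, ⁅t, y⁆ = 0 ∧ y ∉ Submodule.span F {t}
  · obtain ⟨y, hy, hty, hyt⟩ := hc
    obtain ⟨z, hz, hzt, hz'⟩ := (isSemilinearOn_pSpan (F := F) (p := p) y).exists_notMem
      (self_mem_pSpan y) hyt
    have htz : ⁅t, z⁆ = 0 := by
      rw [← lie_skew, lie_eq_zero_of_mem_pSpan _ hz, neg_zero]
      rw [← lie_skew, hty, neg_zero]
    refine ⟨z, 0, by simpa using htz, le_span_pair_of_covBy htM (pSpan_le.2 hy hz) hzt ?_ ?_⟩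
    · rw [htz]; exact Submodule.zero_mem _
    · have hsub : Submodule.span F {t} ≤ Submodule.span F {t, z} := Submodule.span_mono (by simp)
      rcases hz' with h | h
      · exact hsub h
      · have := Submodule.add_mem _ (hsub h) (Submodule.subset_span (by simp) : z ∈ _)
        simpa using this
  · push Not at hc
    obtain ⟨m, hm, hmt⟩ : ∃ m ∈ M, m ∉ Submodule.span F {t} := by
      by_contra! h
      exact htM.lt.not_ge h
    obtain ⟨x, hx, μ, hx0, hμ, htx⟩ := exists_eigenvector_of_toral ht
      (U := M.toSubmodule) (fun u hu => M.lie_mem htM' hu) hm fun h => hmt (hc m hm h)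
    have hpx : φ x = 0 := by
      obtain ⟨c, hc'⟩ := Submodule.mem_span_singleton.1
        (hc _ (M.pMap_mem hx) (lie_pMap_eq_zero_of_eigenvector htx))
      have h0 : ⁅φ x, x⁆ = 0 := lie_pMap_eq_zero (lie_self x)
      rw [← hc', smul_lie, htx, smul_smul] at h0
      have : c = 0 := by simpa [hx0, hμ] using h0
      rw [← hc', this, zero_smul]
    refine ⟨x, μ, htx, le_span_pair_of_covBy htM hx ?_ ?_ ?_⟩
    · intro h
      obtain ⟨c, rfl⟩ := Submodule.mem_span_singleton.1 h
      rw [lie_smul, lie_self, smul_zero] at htx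
      exact hx0 ((smul_eq_zero.1 htx.symm).resolve_left hμ)
    · rw [htx]; exact Submodule.smul_mem _ _ (Submodule.subset_span (by simp))
    · rw [hpx]; exact Submodule.zero_mem _

theorem lie_mem_span_pair {t x a b : L} {μ : F} (htx : ⁅t, x⁆ = μ • x)
    (ha : a ∈ Submodule.span F {t, x}) (hb : b ∈ Submodule.span F {t, x}) :
    ⁅a, b⁆ ∈ Submodule.span F {a, b} := by
  obtain ⟨a₁, a₂, rfl⟩ := Submodule.mem_span_pair.1 ha
  obtain ⟨b₁, b₂, rfl⟩ := Submodule.mem_span_pair.1 hb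
  rw [Submodule.mem_span_pair]
  refine ⟨-(b₁ * μ), a₁ * μ, ?_⟩
  have hxt : ⁅x, t⁆ = -(μ • x) := by rw [← lie_skew, htx]
  simp only [add_lie, lie_add, smul_lie, lie_smul, lie_self, htx, hxt]
  module

/-- In a restricted Lie algebra whose lattice of restricted subalgebras is upper semimodular, any
two eigenvectors of the `p`-mapping span a subalgebra. -/
theorem lie_mem_span_of_isUpperModularLattice [IsAlgClosed F] [FiniteDimensional F L]
    [IsUpperModularLattice (RestrictedSubalgebra F p L)] {a b : L} (ha : φ a = 0 ∨ φ a = a)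
    (hb : φ b = 0 ∨ φ b = b) : ⁅a, b⁆ ∈ Submodule.span F {a, b} := by
  have hline : ∀ {c : L}, (φ c = 0 ∨ φ c = c) → φ c ∈ Submodule.span F {c} := by
    rintro c (h | h) <;> rw [h]
    · exact Submodule.zero_mem _
    · exact Submodule.mem_span_singleton_self c
  by_cases hba : b ∈ Submodule.span F {a}
  · obtain ⟨c, rfl⟩ := Submodule.mem_span_singleton.1 hba
    simp
  by_cases ha0 : a = 0
  · simp [ha0]
  have hb0 : b ≠ 0 := by rintro rfl; simp at hba
  obtain ⟨M, haM, hbM⟩ : ∃ M : RestrictedSubalgebra F p L, line a (hline ha) ⋖ M ∧ b ∈ M :=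
    ⟨_, line_covBy_sup (ha := hline hb) hba, le_sup_left (a := line b (hline hb)) self_mem_line⟩
  have haM' : a ∈ M := haM.le self_mem_line
  by_cases hT : ∃ t ∈ M, t ≠ 0 ∧ φ t = t
  · obtain ⟨t, htM, ht0, ht⟩ := hT
    obtain ⟨x, μ, htx, hM⟩ := exists_le_span_pair_of_toral ht
      (line_covBy_of_mem haM ha0 ht0 (hline (Or.inr ht)) htM)
    exact lie_mem_span_pair htx (hM haM') (hM hbM)
  -- Without nonzero toral elements `M` is nilpotent, hence has a central vector `w ≠ 0` killed or
  -- fixed by the `p`-mapping. Its line is maximal in `M`, so either `a ∈ F w` or `M` is spanned by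
  -- `w` and `a`; in both cases `a` and `b` commute.
  · push Not at hT
    have hnil : LieRing.IsNilpotent M.toLieSubalgebra := by
      refine (LieAlgebra.isNilpotent_iff_forall (R := F)).2 fun x => ?_
      refine LieSubalgebra.isNilpotent_ad_of_isNilpotent_ad _ ?_
      refine isNilpotent_ad_of_toral (p := p) _ fun t htx ht => ?_
      by_contra h
      exact hT t (pSpan_le.2 x.2 htx) (by rintro rfl; simp at h) ht
    have : Nontrivial M.toLieSubalgebra :=
      ⟨⟨a, haM'⟩, 0, fun h => ha0 (congrArg Subtype.val h)⟩
    have := LieModule.nontrivial_max_triv_of_isNilpotent F M.toLieSubalgebra M.toLieSubalgebra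
    obtain ⟨⟨⟨z, hzM⟩, hzc⟩, hz0⟩ := exists_ne
      (0 : LieModule.maxTrivSubmodule F M.toLieSubalgebra M.toLieSubalgebra)
    have hz0' : z ≠ 0 := by rintro rfl; exact hz0 rfl
    rw [LieModule.mem_maxTrivSubmodule] at hzc
    have hzc' : ∀ y ∈ M, ⁅z, y⁆ = 0 := fun y hy => by
      rw [← lie_skew, neg_eq_zero]
      exact congrArg Subtype.val (hzc ⟨y, hy⟩)
    obtain ⟨w, hw, hw0, hw'⟩ := (isSemilinearOn_pSpan (F := F) (p := p) z).exists_notMem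
      (C := ⊥) (self_mem_pSpan z) (by simpa using hz0')
    rw [Submodule.mem_bot] at hw0
    simp only [Submodule.mem_bot, sub_eq_zero] at hw'
    have hwM : w ∈ M := pSpan_le.2 hzM hw
    have hwc : ∀ y ∈ M, ⁅w, y⁆ = 0 := fun y hy => lie_eq_zero_of_mem_pSpan (hzc' y hy) hw
    have hab : ⁅a, b⁆ = 0 := by
      by_cases haw : a ∈ Submodule.span F {w}
      · obtain ⟨c, rfl⟩ := Submodule.mem_span_singleton.1 haw
        rw [smul_lie, hwc b hbM, smul_zero]
      · have hle := le_span_pair_of_covBy (line_covBy_of_mem haM ha0 hw0 (hline hw') hwM) haM' haw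
          (by rw [hwc a haM']; exact Submodule.zero_mem _)
          (Submodule.span_mono (by simp) (hline ha))
        obtain ⟨c, d, rfl⟩ := Submodule.mem_span_pair.1 (hle hbM)
        rw [lie_add, lie_smul, lie_smul, lie_self, ← lie_skew, hwc a haM']
        simp
    rw [hab]
    exact Submodule.zero_mem _

end RestrictedSubalgebra

end Restricted

/-- If `c` and `d` are the `x`-coordinates of `y` and `z`, then `[y, z] = c z - d y`. -/
theorem IsAlmostAbelian.lie_mem_span {F L : Type*} [Field F] [LieRing L] [LieAlgebra F L]
    (h : IsAlmostAbelian F L) (y z : L) : ⁅y, z⁆ ∈ Submodule.span F {y, z} := by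
  obtain ⟨x, A, -, hc, hA, hx⟩ := h
  have hdec : ∀ y : L, ∃ c : F, ∃ a ∈ A, y = c • x + a := by
    intro y
    have : y ∈ Submodule.span F {x} ⊔ A.toSubmodule := hc.sup_eq_top ▸ Submodule.mem_top
    obtain ⟨_, hu, a, ha, rfl⟩ := Submodule.mem_sup.1 this
    obtain ⟨c, rfl⟩ := Submodule.mem_span_singleton.1 hu
    exact ⟨c, a, ha, rfl⟩
  obtain ⟨c, a, ha, rfl⟩ := hdec y
  obtain ⟨d, b, hb, rfl⟩ := hdec z
  rw [Submodule.mem_span_pair]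
  refine ⟨-d, c, ?_⟩
  have hax : ⁅a, x⁆ = -a := by rw [← lie_skew, hx a ha]
  simp only [add_lie, lie_add, smul_lie, lie_smul, lie_self, hx b hb, hax, hA a ha b hb]
  module

/-! ### A noncentral toral element makes the algebra almost abelian -/

section Restricted

variable {F : Type*} {p : ℕ} {L : Type*} [Field F] [Fact p.Prime] [CharP F p]
  [LieRing L] [LieAlgebra F L] [RestrictedLieAlgebra F p L]

local notation "φ" => RestrictedLieAlgebra.pMap F p

open RestrictedLieAlgebra

variable (F p L) in
/-- Any two elements that are fixed or killed by the `p`-mapping span a subalgebra. -/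
def EigenvectorsSpanSubalgebra : Prop :=
  ∀ a b : L, (φ a = 0 ∨ φ a = a) → (φ b = 0 ∨ φ b = b) → ⁅a, b⁆ ∈ Submodule.span F {a, b}

namespace RestrictedSubalgebra

theorem pow_eq_self_of_toral {t x : L} {μ : F} (ht : φ t = t) (hx : x ≠ 0) (htx : ⁅t, x⁆ = μ • x) :
    μ ^ p = μ := by
  have h := LinearMap.congr_fun (ad_pow_of_toral ht) x
  rw [ad_pow_eq_smul htx, LieAlgebra.ad_apply, htx] at h
  exact smul_left_injective F hx h

theorem pMap_inv_smul_of_toral {t : L} {μ : F} (ht : φ t = t) (hμ : μ ^ p = μ) :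
    φ (μ⁻¹ • t) = μ⁻¹ • t := by
  rw [pMap_smul, ht, inv_pow, hμ]

section Pairs

variable [IsAlgClosed F] [FiniteDimensional F L]

theorem pMap_eq_zero_of_lie_eq_self (hP : EigenvectorsSpanSubalgebra F p L)
    {t x : L} (ht : φ t = t) (htx : ⁅t, x⁆ = x) : φ x = 0 := by
  by_cases hx0 : x = 0
  · rw [hx0, pMap_zero]
  have htpx : ⁅t, φ x⁆ = 0 := lie_pMap_eq_zero_of_eigenvector (μ := (1 : F)) (by rw [htx, one_smul])
  have hpxt : ⁅φ x, t⁆ = 0 := by rw [← lie_skew, htpx, neg_zero]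
  -- With `φ c - c = -φ x`, the element `t + x + c` is toral. That it spans a subalgebra with `t`
  -- will force `c = 0`, hence `φ x = 0`.
  obtain ⟨c, hc, hc'⟩ := (isSemilinearOn_pSpan (F := F) (p := p) (φ x)).exists_sub_eq
    ((pSpan F p (φ x)).toSubmodule.neg_mem (self_mem_pSpan _))
  have hcx : ⁅c, x⁆ = 0 := lie_eq_zero_of_mem_pSpan (lie_pMap_eq_zero (lie_self x)) hc
  have hct : ⁅c, t⁆ = 0 := lie_eq_zero_of_mem_pSpan hpxt hc
  have htc : ⁅t, c⁆ = 0 := by rw [← lie_skew, hct, neg_zero]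
  have hxc : ⁅x, c⁆ = 0 := by rw [← lie_skew, hcx, neg_zero]
  have hu : φ (t + x + c) = t + x + c := by
    rw [pMap_add_of_lie_eq_zero, pMap_add_of_lie_eq htx, ht, eq_add_of_sub_eq hc']
    · abel
    · rw [add_lie, htc, hxc, add_zero]
  have h := hP t (t + x + c) (Or.inr ht) (Or.inr hu)
  rw [lie_add, lie_add, lie_self, htx, htc, zero_add, add_zero, Submodule.mem_span_pair] at h
  obtain ⟨a, b, hab⟩ := h
  have h1 := congrArg (fun y => ⁅t, y⁆) hab
  simp only [lie_add, lie_smul, lie_self, htx, htc, smul_zero, zero_add, add_zero] at h1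
  have hb : b = 1 := smul_left_injective F hx0 (by simpa using h1)
  subst hb
  have h2 : (a + 1) • t + c = 0 := by
    have : a • t + (t + x + c) - x = 0 := by rw [sub_eq_zero, ← one_smul F (t + x + c), hab]
    rw [← this]
    module
  have h3 : ⁅(a + 1) • t + c, x⁆ = 0 := by rw [h2, zero_lie]
  rw [add_lie, smul_lie, htx, hcx, add_zero, smul_eq_zero_iff_left hx0] at h3
  rw [h3, zero_smul, zero_add] at h2
  rw [h2, pMap_zero, sub_zero] at hc'
  exact neg_eq_zero.1 hc'.symm

theorem pMap_eq_zero_of_eigenvector (hP : EigenvectorsSpanSubalgebra F p L)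
    {t x : L} {μ : F} (ht : φ t = t) (hμ : μ ≠ 0)
    (htx : ⁅t, x⁆ = μ • x) : φ x = 0 := by
  by_cases hx0 : x = 0
  · rw [hx0, pMap_zero]
  · refine pMap_eq_zero_of_lie_eq_self hP
      (pMap_inv_smul_of_toral ht (pow_eq_self_of_toral ht hx0 htx)) ?_
    rw [smul_lie, htx, smul_smul, inv_mul_cancel₀ hμ, one_smul]

/-- `[x, y] = a x + b y` has weight `μ + ν`, which leaves `a ν x + b μ y = 0`; applying `ad t` gives
`μ ν [x, y] = 0`. -/
theorem lie_eq_zero_of_eigenvectors (hP : EigenvectorsSpanSubalgebra F p L)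
    {t x y : L} {μ ν : F} (ht : φ t = t) (hμ : μ ≠ 0) (hν : ν ≠ 0)
    (htx : ⁅t, x⁆ = μ • x) (hty : ⁅t, y⁆ = ν • y) : ⁅x, y⁆ = 0 := by
  have h := hP x y (Or.inl (pMap_eq_zero_of_eigenvector hP ht hμ htx))
    (Or.inl (pMap_eq_zero_of_eigenvector hP ht hν hty))
  obtain ⟨a, b, hab⟩ := Submodule.mem_span_pair.1 h
  have h1 : ⁅t, ⁅x, y⁆⁆ = (μ + ν) • ⁅x, y⁆ := by
    rw [leibniz_lie, htx, hty, smul_lie, lie_smul]; module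
  rw [← hab, lie_add, lie_smul, lie_smul, htx, hty] at h1
  have h2 : (a * ν) • x + (b * μ) • y = 0 := by
    have := sub_eq_zero.2 h1.symm
    rw [← this]
    module
  have h3 : ⁅t, (a * ν) • x + (b * μ) • y⁆ = 0 := by rw [h2, lie_zero]
  rw [lie_add, lie_smul, lie_smul, htx, hty] at h3
  rw [← hab]
  have h4 : (μ * ν) • (a • x + b • y) = 0 := by
    rw [← h3]
    module
  exact (smul_eq_zero.1 h4).resolve_left (mul_ne_zero hμ hν)

/-- The sum `x + y` is killed by the `p`-mapping, so `[t, x + y] = a t + b (x + y)`. For distinct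
weights, comparing components after `ad t` would give `b = μ` and `b = ν`. -/
theorem eigenvalue_eq (hP : EigenvectorsSpanSubalgebra F p L)
    {t x y : L} {μ ν : F} (ht : φ t = t) (hμ : μ ≠ 0) (hν : ν ≠ 0) (hx : x ≠ 0)
    (hy : y ≠ 0) (htx : ⁅t, x⁆ = μ • x) (hty : ⁅t, y⁆ = ν • y) : μ = ν := by
  have hpx := pMap_eq_zero_of_eigenvector hP ht hμ htx
  have hpy := pMap_eq_zero_of_eigenvector hP ht hν hty
  have hxy : φ (x + y) = 0 := by
    rw [pMap_add_of_lie_eq_zero (lie_eq_zero_of_eigenvectors hP ht hμ hν htx hty), hpx, hpy,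
      add_zero]
  obtain ⟨a, b, hab⟩ := Submodule.mem_span_pair.1 (hP t (x + y) (Or.inr ht) (Or.inl hxy))
  rw [lie_add, htx, hty] at hab
  have h1 := congrArg (fun z => ⁅t, z⁆) hab
  simp only [lie_add, lie_smul, lie_self, htx, hty, smul_zero, zero_add] at h1
  have h2 := congrArg (fun z => ⁅t, z⁆) h1
  simp only [lie_add, lie_smul, htx, hty] at h2
  by_contra hne
  have h3 : ((b - μ) * μ * (ν - μ)) • x = 0 := by
    have e1 := sub_eq_zero.2 h1
    have e2 := sub_eq_zero.2 h2
    have : ν • (0 : L) - 0 = 0 := by simp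
    rw [← this]
    nth_rewrite 1 [← e1]
    rw [← e2]
    module
  have h4 : ((b - ν) * ν * (μ - ν)) • y = 0 := by
    have e1 := sub_eq_zero.2 h1
    have e2 := sub_eq_zero.2 h2
    have : μ • (0 : L) - 0 = 0 := by simp
    rw [← this]
    nth_rewrite 1 [← e1]
    rw [← e2]
    module
  have hb1 : b = μ := by
    have := (smul_eq_zero.1 h3).resolve_right hx
    simpa [hμ, sub_eq_zero, Ne.symm hne] using this
  have hb2 : b = ν := by
    have := (smul_eq_zero.1 h4).resolve_right hy
    simpa [hν, sub_eq_zero, hne] using this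
  exact hne (hb1 ▸ hb2)

theorem mem_span_of_lie_eq_zero_of_pMap (hP : EigenvectorsSpanSubalgebra F p L)
    {t x c : L} (ht : φ t = t) (hx : x ≠ 0) (htx : ⁅t, x⁆ = x)
    (htc : ⁅t, c⁆ = 0) (hc : φ c = 0 ∨ φ c = c) : c ∈ Submodule.span F {t} := by
  by_contra hct
  have hc0 : c ≠ 0 := by rintro rfl; simp at hct
  have hpx := pMap_eq_zero_of_lie_eq_self hP ht htx
  obtain ⟨b, hcx⟩ : ∃ b : F, ⁅c, x⁆ = b • x := by
    obtain ⟨a, b, hab⟩ := Submodule.mem_span_pair.1 (hP c x hc (Or.inl hpx))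
    refine ⟨b, ?_⟩
    have h1 : ⁅t, ⁅c, x⁆⁆ = ⁅c, x⁆ := by rw [leibniz_lie, htc, htx, zero_lie, zero_add]
    rw [← hab, lie_add, lie_smul, lie_smul, htc, htx, smul_zero, zero_add] at h1
    rw [← hab, ← h1]
  rcases hc with hc | hc
  · have hb : b = 0 := by
      have h1 : ⁅φ c, x⁆ = b ^ p • x := by rw [lie_pMap, ad_pow_eq_smul hcx]
      rw [hc, zero_lie] at h1
      exact eq_zero_of_pow_eq_zero ((smul_eq_zero.1 h1.symm).resolve_right hx)
    rw [hb, zero_smul] at hcx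
    have hcx' : φ (c + x) = 0 := by rw [pMap_add_of_lie_eq_zero hcx, hc, hpx, add_zero]
    obtain ⟨a, d, had⟩ := Submodule.mem_span_pair.1 (hP t (c + x) (Or.inr ht) (Or.inl hcx'))
    rw [lie_add, htc, htx, zero_add] at had
    have h1 := congrArg (fun z => ⁅t, z⁆) had
    simp only [lie_add, lie_smul, lie_self, htc, htx, smul_zero, zero_add] at h1
    have hd : d = 1 := smul_left_injective F hx (by simpa using h1)
    rw [hd, one_smul, ← add_assoc, add_eq_right] at had
    exact hct (Submodule.mem_span_singleton.2
      ⟨-a, by rw [neg_smul, eq_neg_of_add_eq_zero_right had]⟩)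
  · have hb := pow_eq_self_of_toral hc hx hcx
    have hct' : ⁅c, t⁆ = 0 := by rw [← lie_skew, htc, neg_zero]
    have hcomm : ∀ e : F, ⁅c, e • t⁆ = 0 := fun e => by rw [lie_smul, hct', smul_zero]
    -- The correction by `t` makes this toral element act as the identity on `x`, so its bracket
    -- with the toral element `t + x` is `x`.
    have hu : φ (c + (1 - b) • t) = c + (1 - b) • t := by
      rw [pMap_add_of_lie_eq_zero (hcomm _), pMap_smul, hc, ht, sub_pow_char, hb, one_pow]
    have hw : φ (t + x) = t + x := by rw [pMap_add_of_lie_eq htx, ht, hpx, add_zero]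
    obtain ⟨a, d, had⟩ := Submodule.mem_span_pair.1 (hP _ _ (Or.inr hu) (Or.inr hw))
    have h0 : ⁅c + (1 - b) • t, t + x⁆ = x := by
      simp only [add_lie, lie_add, smul_lie, hct', hcx, htx, lie_self]
      module
    rw [h0] at had
    have h1 := congrArg (fun z => ⁅t, z⁆) had
    simp only [lie_add, lie_smul, lie_self, htc, htx, smul_zero, zero_add] at h1
    have hd : d = 1 := smul_left_injective F hx (by simpa using h1)
    subst hd
    have h2 : a • c = (-(a * (1 - b) + 1)) • t := by
      rw [← sub_eq_zero, ← sub_eq_zero.2 had]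
      module
    by_cases ha : a = 0
    · rw [ha, zero_smul, zero_mul, zero_add, neg_smul, one_smul, eq_comm, neg_eq_zero] at h2
      rw [h2, zero_lie] at htx
      exact hx htx.symm
    · exact hct ((Submodule.smul_mem_iff _ ha).1 (h2 ▸ Submodule.smul_mem _ _
        (Submodule.mem_span_singleton_self t)))

theorem mem_span_of_lie_eq_zero (hP : EigenvectorsSpanSubalgebra F p L)
    {t x c : L} (ht : φ t = t) (hx : x ≠ 0) (htx : ⁅t, x⁆ = x)
    (htc : ⁅t, c⁆ = 0) : c ∈ Submodule.span F {t} := by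
  by_contra hct
  obtain ⟨z, hz, hzt, hz'⟩ := (isSemilinearOn_pSpan (F := F) (p := p) c).exists_notMem
    (self_mem_pSpan c) hct
  have hzc : ⁅z, t⁆ = 0 := lie_eq_zero_of_mem_pSpan (by rw [← lie_skew, htc, neg_zero]) hz
  have hz2 : ∀ e : F, ⁅z, e • t⁆ = 0 := fun e => by rw [lie_smul, hzc, smul_zero]
  have hp := (Fact.out : p.Prime)
  -- It remains to correct `z` by a multiple of `t` so that it is killed or fixed exactly: a `p`-th
  -- root does the former, a root of the Artin–Schreier polynomial `X ^ p - X + a` the latter.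
  have key : ∀ e : F, (φ (z + e • t) = 0 ∨ φ (z + e • t) = z + e • t) → False := by
    intro e he
    have := mem_span_of_lie_eq_zero_of_pMap hP ht hx htx
      (by rw [lie_add, lie_smul, lie_self, smul_zero, add_zero, ← lie_skew, hzc, neg_zero]) he
    apply hzt
    have := Submodule.sub_mem _ this (Submodule.smul_mem _ e (Submodule.mem_span_singleton_self t))
    simpa using this
  rcases hz' with h | h
  · obtain ⟨a, ha⟩ := Submodule.mem_span_singleton.1 h
    obtain ⟨e, he⟩ := IsAlgClosed.exists_pow_nat_eq (-a) hp.pos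
    refine key e (Or.inl ?_)
    rw [pMap_add_of_lie_eq_zero (hz2 e), pMap_smul, ht, ← ha, he]
    module
  · obtain ⟨a, ha⟩ := Submodule.mem_span_singleton.1 h
    have hdeg : (Polynomial.X ^ p - Polynomial.X + Polynomial.C a : Polynomial F).degree ≠ 0 := by
      intro h
      have hd : Polynomial.derivative (Polynomial.X ^ p - Polynomial.X + Polynomial.C a) = -1 := by
        simp [Polynomial.derivative_pow]
      rw [Polynomial.eq_C_of_degree_eq_zero h, Polynomial.derivative_C] at hd
      simp at hd
    obtain ⟨e, he⟩ := IsAlgClosed.exists_root _ hdeg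
    have he' : e ^ p = e - a := by
      simp at he
      linear_combination he
    refine key e (Or.inr ?_)
    rw [pMap_add_of_lie_eq_zero (hz2 e), pMap_smul, ht, he', eq_add_of_sub_eq ha.symm]
    module

theorem isAlmostAbelian_of_toral (hP : EigenvectorsSpanSubalgebra F p L)
    {t u : L} (ht : φ t = t) (htu : ⁅t, u⁆ ≠ 0) :
    IsAlmostAbelian F L := by
  -- Nonzero weights lie in the prime field, so rescaling `t` by the inverse of one keeps it toral
  -- and makes that weight 1.
  wlog h : ∃ x : L, x ≠ 0 ∧ ⁅t, x⁆ = x generalizing t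
  · obtain ⟨x, -, μ, hx, hμ, htx⟩ := exists_eigenvector_of_toral ht (U := ⊤) (by simp)
      Submodule.mem_top htu
    refine this (pMap_inv_smul_of_toral ht (pow_eq_self_of_toral ht hx htx)) ?_ ⟨x, hx, ?_⟩
    · rw [smul_lie]
      exact smul_ne_zero (inv_ne_zero hμ) htu
    · rw [smul_lie, htx, smul_smul, inv_mul_cancel₀ hμ, one_smul]
  obtain ⟨x, hx, htx⟩ := h
  have hdec : Submodule.span F {t} ⊔ (LieAlgebra.ad F L t).eigenspace 1 = ⊤ := by
    rw [eq_top_iff, ← Module.End.iSup_eigenspace_eq_top_of_pow_eq_self (ad_pow_of_toral ht)]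
    refine iSup_le fun μ y hy => ?_
    have hy' : ⁅t, y⁆ = μ • y := Module.End.mem_eigenspace_iff.1 hy
    by_cases hμ : μ = 0
    · rw [hμ, zero_smul] at hy'
      exact Submodule.mem_sup_left (mem_span_of_lie_eq_zero hP ht hx htx hy')
    · by_cases hy0 : y = 0
      · rw [hy0]; exact Submodule.zero_mem _
      · rw [eigenvalue_eq hP ht hμ one_ne_zero hy0 hx hy' (by rw [htx, one_smul])] at hy
        exact Submodule.mem_sup_right hy
  have heig : ∀ {a}, a ∈ (LieAlgebra.ad F L t).eigenspace 1 → ⁅t, a⁆ = (1 : F) • a :=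
    fun ha => Module.End.mem_eigenspace_iff.1 ha
  have hab : ∀ {a b}, a ∈ (LieAlgebra.ad F L t).eigenspace 1 →
      b ∈ (LieAlgebra.ad F L t).eigenspace 1 → ⁅a, b⁆ = 0 := fun ha hb =>
    lie_eq_zero_of_eigenvectors hP ht one_ne_zero one_ne_zero (heig ha) (heig hb)
  let A : LieIdeal F L :=
    { (LieAlgebra.ad F L t).eigenspace 1 with
      lie_mem := by
        intro l a ha
        change a ∈ (LieAlgebra.ad F L t).eigenspace 1 at ha
        change ⁅l, a⁆ ∈ (LieAlgebra.ad F L t).eigenspace 1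
        obtain ⟨s, hs, b, hb, rfl⟩ := Submodule.mem_sup.1 (hdec ▸ Submodule.mem_top :
          l ∈ Submodule.span F {t} ⊔ (LieAlgebra.ad F L t).eigenspace 1)
        obtain ⟨c, rfl⟩ := Submodule.mem_span_singleton.1 hs
        rw [add_lie, hab hb ha, smul_lie, heig ha, add_zero]
        exact Submodule.smul_mem _ _ (Submodule.smul_mem _ _ ha) }
  have ht0 : t ≠ 0 := by rintro rfl; simp at htu
  refine ⟨t, A, ht0, ⟨?_, codisjoint_iff.2 hdec⟩, fun a ha b hb => hab ha hb,
    fun a ha => by rw [heig ha, one_smul]⟩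
  rw [Submodule.disjoint_def]
  intro y hy hyA
  obtain ⟨c, rfl⟩ := Submodule.mem_span_singleton.1 hy
  have := heig hyA
  simpa using this.symm

end Pairs

end RestrictedSubalgebra

end Restricted

section Restricted

variable {F : Type*} {p : ℕ} {L : Type*} [Field F] [Fact p.Prime] [CharP F p]
  [LieRing L] [LieAlgebra F L] [RestrictedLieAlgebra F p L]

local notation "φ" => RestrictedLieAlgebra.pMap F p

open RestrictedLieAlgebra

namespace RestrictedSubalgebra

/-! ### Nilpotent restricted Lie algebras -/

theorem isNilpotent_of_toral [IsAlgClosed F] [FiniteDimensional F L]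
    (h : ∀ t u : L, φ t = t → ⁅t, u⁆ = 0) : LieRing.IsNilpotent L :=
  (LieAlgebra.isNilpotent_iff_forall (R := F)).2 fun x =>
    isNilpotent_ad_of_toral (p := p) x fun t _ ht => by
      ext u
      exact h t u ht

/-- Take the last term of the lower central series whose intersection with `T` is not inside `S`;
brackets with `S` push it into the next term. -/
theorem exists_normalizing_of_lt [LieRing.IsNilpotent L] {S T : RestrictedSubalgebra F p L}
    (h : S < T) : ∃ y ∈ T, y ∉ S ∧ ∀ u ∈ S, ⁅y, u⁆ ∈ S := by
  classical
  obtain ⟨n, hn⟩ := LieModule.IsNilpotent.nilpotent F L L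
  have hex : ∃ k, ∀ y ∈ T, y ∈ LieModule.lowerCentralSeries F L L k → y ∈ S :=
    ⟨n, fun y _ hy => by
      rw [hn, LieSubmodule.mem_bot] at hy
      exact hy ▸ S.zero_mem⟩
  have hk := Nat.find_spec hex
  have hmin := fun m => Nat.find_min hex (m := m)
  generalize Nat.find hex = k at *
  rcases k with _ | k
  · exact absurd (fun y hy => hk y hy (by simp)) h.not_ge
  · have := hmin k (Nat.lt_succ_self k)
    push Not at this
    obtain ⟨y, hy, hyk, hyS⟩ := this
    refine ⟨y, hy, hyS, fun u hu => hk _ (T.lie_mem hy (h.le hu)) ?_⟩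
    rw [← lie_skew, LieModule.lowerCentralSeries_succ]
    exact neg_mem (LieSubmodule.lie_mem_lie (LieSubmodule.mem_top u) hyk)

/-- The whole of `⟨y⟩_p` normalizes `S` and contains some `z ∉ S` killed or fixed modulo `S`, so `S
+ F z` is a restricted subalgebra and equals `T`. -/
theorem finrank_le_of_covBy [IsAlgClosed F] [FiniteDimensional F L] [LieRing.IsNilpotent L]
    {S T : RestrictedSubalgebra F p L} (h : S ⋖ T) :
    Module.finrank F T.toSubmodule ≤ Module.finrank F S.toSubmodule + 1 := by
  obtain ⟨y, hyT, hyS, hn⟩ := exists_normalizing_of_lt h.lt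
  obtain ⟨z, hz, hzS, hz'⟩ := (isSemilinearOn_pSpan (F := F) (p := p) y).exists_notMem
    (self_mem_pSpan y) (C := S.toSubmodule) hyS
  have hzn : ∀ u ∈ S, ⁅z, u⁆ ∈ S := fun u hu => lie_mem_of_mem_pSpan hn hz hu
  have hspan : Submodule.span F ((S.toSubmodule : Set L) ∪ {z}) =
      S.toSubmodule ⊔ Submodule.span F {z} := by
    rw [Submodule.span_union, Submodule.span_eq]
  let U : RestrictedSubalgebra F p L := ofSpan ((S.toSubmodule : Set L) ∪ {z})
    (by
      rw [hspan]
      rintro x (hx | rfl) w (hw | rfl)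
      · exact Submodule.mem_sup_left (S.lie_mem hx hw)
      · rw [← lie_skew]
        exact Submodule.mem_sup_left (S.toSubmodule.neg_mem (hzn x hx))
      · exact Submodule.mem_sup_left (hzn w hw)
      · rw [lie_self]; exact Submodule.zero_mem _)
    (by
      rw [hspan]
      rintro x (hx | rfl)
      · exact Submodule.mem_sup_left (S.pMap_mem hx)
      · rcases hz' with h' | h'
        · exact Submodule.mem_sup_left h'
        · have := Submodule.add_mem _ (Submodule.mem_sup_left (T := Submodule.span F {x}) h')
            (Submodule.mem_sup_right (Submodule.mem_span_singleton_self x))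
          rwa [sub_add_cancel] at this)
  have hSU : S ≤ U := fun x hx => subset_ofSpan (Or.inl hx)
  have hUT : U ≤ T := by
    refine ofSpan_le.2 ?_
    rintro x (hx | rfl)
    · exact h.le hx
    · exact pSpan_le.2 hyT hz
  have hUS : U ≠ S := fun h' => hzS (h' ▸ subset_ofSpan (Or.inr rfl) : z ∈ S)
  have hU : U = T := (h.eq_or_eq hSU hUT).resolve_left hUS
  have hU' : T.toSubmodule = S.toSubmodule ⊔ Submodule.span F {z} := by
    rw [← hU, ← hspan]; rfl
  rw [hU']
  refine (Submodule.finrank_add_le_finrank_add_finrank _ _).trans ?_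
  gcongr
  simpa using finrank_span_le_card (R := F) ({z} : Set L)

theorem finrank_lt_of_lt [FiniteDimensional F L] {S T : RestrictedSubalgebra F p L} (h : S < T) :
    Module.finrank F S.toSubmodule < Module.finrank F T.toSubmodule :=
  Submodule.finrank_lt_finrank_of_lt (toSubmodule_strictMono h)

/-- Climb from `S ⊓ T` to `S` by covers. At each cover the join with `T` either stays or, by
semimodularity, is covered, hence gains at most one dimension, while `S` gains at least one. -/
theorem finrank_sup_add_finrank_inf_le [IsAlgClosed F] [FiniteDimensional F L]
    [LieRing.IsNilpotent L] [IsUpperModularLattice (RestrictedSubalgebra F p L)]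
    (S T : RestrictedSubalgebra F p L) :
    Module.finrank F (S ⊔ T).toSubmodule + Module.finrank F (S ⊓ T).toSubmodule ≤
      Module.finrank F S.toSubmodule + Module.finrank F T.toSubmodule := by
  have hwf : WellFoundedLT (RestrictedSubalgebra F p L) :=
    toSubmodule_strictMono.wellFoundedLT
  induction S using WellFoundedLT.induction with
  | ind S ih =>
    by_cases hST : S ≤ T
    · rw [sup_eq_right.2 hST, inf_eq_left.2 hST, add_comm]
    · obtain ⟨Y, hY, hYS⟩ := exists_le_covBy_of_lt (inf_lt_left.2 hST)
      have hinf : Y ⊓ T = S ⊓ T :=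
        le_antisymm (inf_le_inf_right _ hYS.le) (le_inf hY inf_le_right)
      have hsup : S ⊔ (Y ⊔ T) = S ⊔ T := by rw [← sup_assoc, sup_eq_left.2 hYS.le]
      have hIH := ih Y hYS.lt
      rw [hinf] at hIH
      have hlt := finrank_lt_of_lt hYS.lt
      rcases hYS.eq_or_eq (c := S ⊓ (Y ⊔ T)) (le_inf hYS.le le_sup_left) inf_le_left with h | h
      · have hc : Y ⊔ T ⋖ S ⊔ (Y ⊔ T) := covBy_sup_of_inf_covBy_left (by rw [h]; exact hYS)
        rw [hsup] at hc
        have := finrank_le_of_covBy hc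
        omega
      · rw [← hsup, sup_eq_right.2 (inf_eq_left.1 h)]
        omega

/-- By dimension, the join cannot exceed the sum of subspaces it contains. -/
theorem isQuasiIdeal_of_isUpperModularLattice [IsAlgClosed F] [FiniteDimensional F L]
    [LieRing.IsNilpotent L] [IsUpperModularLattice (RestrictedSubalgebra F p L)]
    (S : RestrictedSubalgebra F p L) : S.IsQuasiIdeal := by
  intro T s hs t ht
  have hle : S.toSubmodule ⊔ T.toSubmodule ≤ (S ⊔ T).toSubmodule :=
    sup_le (le_sup_left (a := S)) (le_sup_right (a := S))
  have hinf : (S ⊓ T).toSubmodule = S.toSubmodule ⊓ T.toSubmodule := by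
    ext x
    exact mem_inf
  have h1 := finrank_sup_add_finrank_inf_le S T
  have h2 := Submodule.finrank_sup_add_finrank_inf_eq S.toSubmodule T.toSubmodule
  rw [hinf] at h1
  rw [Submodule.eq_of_le_of_finrank_le hle (by omega)]
  exact (S ⊔ T).lie_mem (le_sup_left (a := S) hs) (le_sup_right (a := S) ht)

end RestrictedSubalgebra

/-! ### The nilpotency class -/

/-- The subspace `[x, U] + [y, U]`. -/
def adSup {F L : Type*} [Field F] [LieRing L] [LieAlgebra F L] (x y : L) (U : Submodule F L) :
    Submodule F L :=
  U.map (LieAlgebra.ad F L x) ⊔ U.map (LieAlgebra.ad F L y)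

section adSup

variable {x y : L} {U V : Submodule F L}

theorem adSup_le : adSup x y U ≤ V ↔ ∀ u ∈ U, ⁅x, u⁆ ∈ V ∧ ⁅y, u⁆ ∈ V := by
  simp only [adSup, sup_le_iff, Submodule.map_le_iff_le_comap]
  exact ⟨fun h u hu => ⟨h.1 hu, h.2 hu⟩, fun h => ⟨fun u hu => (h u hu).1, fun u hu => (h u hu).2⟩⟩

theorem lie_left_mem_adSup {u : L} (hu : u ∈ U) : ⁅x, u⁆ ∈ adSup x y U := (adSup_le.1 le_rfl u hu).1

theorem lie_right_mem_adSup {u : L} (hu : u ∈ U) : ⁅y, u⁆ ∈ adSup x y U :=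
  (adSup_le.1 le_rfl u hu).2

theorem adSup_mono (h : U ≤ V) : adSup x y U ≤ adSup x y V :=
  adSup_le.2 fun _ hu => ⟨lie_left_mem_adSup (h hu), lie_right_mem_adSup (h hu)⟩

/-- Such a `U` lies in every term of the lower central series. -/
theorem eq_bot_of_le_adSup [LieRing.IsNilpotent L] (h : U ≤ adSup x y U) : U = ⊥ := by
  have hk : ∀ k, U ≤ (LieModule.lowerCentralSeries F L L k).toSubmodule := by
    intro k
    induction k with
    | zero => simp
    | succ k ih =>
      refine h.trans (adSup_le.2 fun u hu => ?_)
      rw [LieModule.lowerCentralSeries_succ]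
      exact ⟨LieSubmodule.lie_mem_lie (LieSubmodule.mem_top _) (ih hu),
        LieSubmodule.lie_mem_lie (LieSubmodule.mem_top _) (ih hu)⟩
  obtain ⟨n, hn⟩ := LieModule.IsNilpotent.nilpotent F L L
  have := hk n
  rw [hn] at this
  exact eq_bot_iff.2 this

/-- The smallest subspace that contains `[x, y]` and is stable under `ad x` and `ad y`. -/
theorem exists_adSup_generated (F : Type*) [Field F] [LieAlgebra F L] (x y : L) :
    ∃ V : Submodule F L, ⁅x, y⁆ ∈ V ∧ adSup x y V ≤ V ∧
      V ≤ Submodule.span F {⁅x, y⁆} ⊔ adSup x y V := by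
  let V : Submodule F L := sInf {U | ⁅x, y⁆ ∈ U ∧ adSup x y U ≤ U}
  have h1 : ⁅x, y⁆ ∈ V := Submodule.mem_sInf.2 fun U hU => hU.1
  have h2 : adSup x y V ≤ V := le_sInf fun U hU => (adSup_mono (sInf_le hU)).trans hU.2
  refine ⟨V, h1, h2, sInf_le ⟨Submodule.mem_sup_left (Submodule.mem_span_singleton_self _), ?_⟩⟩
  refine le_sup_of_le_right (adSup_mono (sup_le ?_ h2))
  rwa [Submodule.span_singleton_le_iff_mem]

end adSup

namespace RestrictedSubalgebra

/-- The action on `v` of an element of the restricted subalgebra generated by `u`. -/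
theorem exists_lie_eq_of_mem_pSpan {u v s : L} {W : Submodule F L} (hu : ∀ w ∈ W, ⁅u, w⁆ ∈ W)
    (hW : ⁅u, ⁅u, ⁅u, v⁆⁆⁆ ∈ W) (hs : s ∈ pSpan F p u) :
    ∃ (a b : F), ∃ w ∈ W, ⁅s, v⁆ = a • ⁅u, v⁆ + b • ⁅u, ⁅u, v⁆⁆ + w := by
  refine pSpan_induction (P := fun s => ∃ (a b : F), ∃ w ∈ W,
    ⁅s, v⁆ = a • ⁅u, v⁆ + b • ⁅u, ⁅u, v⁆⁆ + w) ?_ ?_ ?_ ?_ hs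
  · intro i
    rw [← LieAlgebra.ad_apply (R := F), ad_iterate_pMap]
    have : p ^ i ≠ 0 := pow_ne_zero _ (Fact.out : p.Prime).ne_zero
    generalize p ^ i = n at *
    rcases n with _ | _ | _ | n
    · exact absurd rfl this
    · exact ⟨1, 0, 0, W.zero_mem, by simp⟩
    · exact ⟨0, 1, 0, W.zero_mem, by simp [pow_succ]⟩
    · refine ⟨0, 0, _, ad_pow_mem hu hW n, ?_⟩
      simp [pow_succ]
  · exact ⟨0, 0, 0, W.zero_mem, by simp⟩
  · rintro s t ⟨a, b, w, hw, h⟩ ⟨a', b', w', hw', h'⟩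
    refine ⟨a + a', b + b', w + w', W.add_mem hw hw', ?_⟩
    rw [add_lie, h, h']
    module
  · rintro c s ⟨a, b, w, hw, h⟩
    refine ⟨c * a, c * b, c • w, W.smul_mem c hw, ?_⟩
    rw [smul_lie, h]
    module

/-- Write `[u, v] = s + r` along the two `p`-spans and bracket with `v`: `r` drops out and `s` acts
as `a ad u + b (ad u) ^ 2` up to deeper terms. The coefficient `a` vanishes since `[u, v]` is not in
`adSup x y V`. The quadratic term can come only from `p = 2`. -/
theorem exists_lie_lie_eq {x y u v : L} {V : Submodule F L}
    (hu : ∀ U : Submodule F L, ∀ m ∈ U, ⁅u, m⁆ ∈ adSup x y U)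
    (hv : ∀ U : Submodule F L, ∀ m ∈ U, ⁅v, m⁆ ∈ adSup x y U) (hV : ⁅u, v⁆ ∈ V)
    (hVV : adSup x y V ≤ V) (huv : ⁅u, v⁆ ∉ adSup x y V)
    (hQ : ⁅u, v⁆ ∈ (pSpan F p u).toSubmodule ⊔ (pSpan F p v).toSubmodule) :
    ∃ (b : F), ∃ w ∈ adSup x y (adSup x y V), ⁅v, ⁅u, v⁆⁆ = b • ⁅u, ⁅u, v⁆⁆ + w := by
  obtain ⟨s, hs, r, hr, hsr⟩ := Submodule.mem_sup.1 hQ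
  have hrv : ⁅r, v⁆ = 0 := lie_eq_zero_of_mem_pSpan (lie_self v) hr
  have hVV2 := adSup_mono (x := x) (y := y) hVV
  obtain ⟨a, b, w, hw, h⟩ := exists_lie_eq_of_mem_pSpan (v := v)
    (W := adSup x y (adSup x y V)) (fun w hw => hVV2 |> adSup_mono <| hu _ _ hw)
    (hu _ _ (hu _ _ hV)) hs
  have h1 : ⁅v, ⁅u, v⁆⁆ = -(a • ⁅u, v⁆ + b • ⁅u, ⁅u, v⁆⁆ + w) := by
    rw [← h, ← lie_skew]
    nth_rewrite 1 [← hsr]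
    rw [add_lie, hrv, add_zero]
  have ha : a = 0 := by
    by_contra ha
    apply huv
    rw [← Submodule.smul_mem_iff _ ha]
    have : a • ⁅u, v⁆ = -(⁅v, ⁅u, v⁆⁆ + b • ⁅u, ⁅u, v⁆⁆ + w) := by rw [h1]; module
    rw [this]
    exact Submodule.neg_mem _ (Submodule.add_mem _ (Submodule.add_mem _ (hv _ _ hV)
      (Submodule.smul_mem _ _ (hu _ _ hV))) (hVV2 hw))
  refine ⟨-b, -w, Submodule.neg_mem _ hw, ?_⟩
  rw [h1, ha]
  module

theorem lie_lie_eq_zero [LieRing.IsNilpotent L]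
    (hQ : ∀ x y : L, ⁅x, y⁆ ∈ (pSpan F p x).toSubmodule ⊔ (pSpan F p y).toSubmodule) (x y : L) :
    ⁅x, ⁅x, y⁆⁆ = 0 := by
  obtain ⟨V, hV, hVV, hVs⟩ := exists_adSup_generated F x y
  by_cases hc : ⁅x, y⁆ ∈ adSup x y V
  · have : V = ⊥ := eq_bot_of_le_adSup
      (hVs.trans (sup_le (by rwa [Submodule.span_singleton_le_iff_mem]) le_rfl))
    rw [this, Submodule.mem_bot] at hV
    rw [hV, lie_zero]
  · obtain ⟨b, w, hw, h⟩ := exists_lie_lie_eq (fun _ _ => lie_left_mem_adSup)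
      (fun _ _ => lie_right_mem_adSup) hV hVV hc (hQ x y)
    -- Replacing `y` by `y - b x` makes its bracket with `[x, y]` equal to `w`, hence deep. The same
    -- relation with the roles exchanged then makes `[x, [x, y]]` deep as well, so `adSup x y V`
    -- lies in its own `adSup` and vanishes.
    have hxy : ⁅y - b • x, x⁆ = -⁅x, y⁆ := by
      rw [sub_lie, smul_lie, lie_self, smul_zero, sub_zero, lie_skew]
    obtain ⟨b', w', hw', h'⟩ := exists_lie_lie_eq (x := x) (y := y) (V := V)
      (u := y - b • x) (v := x)
      (fun _ _ hm => by
        rw [sub_lie, smul_lie]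
        exact Submodule.sub_mem _ (lie_right_mem_adSup hm)
          (Submodule.smul_mem _ _ (lie_left_mem_adSup hm)))
      (fun _ _ => lie_left_mem_adSup) (by rw [hxy]; exact V.neg_mem hV) hVV
      (by rwa [hxy, Submodule.neg_mem_iff]) (hQ _ _)
    have hA : ⁅x, ⁅x, y⁆⁆ ∈ adSup x y (adSup x y V) := by
      have : ⁅x, ⁅x, y⁆⁆ = b' • w - w' := by
        rw [hxy, lie_neg, lie_neg, sub_lie, smul_lie, h] at h'
        rw [← neg_neg ⁅x, ⁅x, y⁆⁆, h']
        module
      rw [this]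
      exact Submodule.sub_mem _ (Submodule.smul_mem _ _ hw) hw'
    have hB : ⁅y, ⁅x, y⁆⁆ ∈ adSup x y (adSup x y V) := by
      rw [h]
      exact Submodule.add_mem _ (Submodule.smul_mem _ _ hA) hw
    have hle : adSup x y V ≤ adSup x y (adSup x y V) := by
      refine adSup_le.2 fun m hm => ?_
      obtain ⟨n, hn, m, hm', rfl⟩ := Submodule.mem_sup.1 (hVs hm)
      obtain ⟨e, rfl⟩ := Submodule.mem_span_singleton.1 hn
      rw [lie_add, lie_add, lie_smul, lie_smul]
      exact ⟨Submodule.add_mem _ (Submodule.smul_mem _ _ hA) (lie_left_mem_adSup hm'),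
        Submodule.add_mem _ (Submodule.smul_mem _ _ hB) (lie_right_mem_adSup hm')⟩
    have h0 : adSup x y V = ⊥ := eq_bot_of_le_adSup hle
    have := lie_left_mem_adSup (x := x) (y := y) hV
    rwa [h0, Submodule.mem_bot] at this

theorem lowerCentralSeries_two_eq_bot [LieRing.IsNilpotent L]
    (hQ : ∀ x y : L, ⁅x, y⁆ ∈ (pSpan F p x).toSubmodule ⊔ (pSpan F p y).toSubmodule) :
    LieModule.lowerCentralSeries F L L 2 = ⊥ := by
  have hE := lie_lie_eq_zero hQ
  -- Since `(ad x) ^ 2 = 0`, proper `p`-powers of `x` are central, and `⟨x⟩_p` acts through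
  -- multiples of `ad x`.
  have hspan : ∀ {x s : L}, s ∈ pSpan F p x → ∃ a : F, ∀ z : L, ⁅s, z⁆ = a • ⁅x, z⁆ := by
    intro x s hs
    refine pSpan_induction (P := fun s => ∃ a : F, ∀ z : L, ⁅s, z⁆ = a • ⁅x, z⁆) ?_ ?_ ?_ ?_ hs
    · rintro (_ | i)
      · exact ⟨1, fun z => by simp⟩
      · refine ⟨0, fun z => ?_⟩
        obtain ⟨m, hm⟩ : ∃ m, p ^ (i + 1) = m + 2 := by
          have := Nat.lt_pow_self (n := i + 1) (Fact.out : p.Prime).one_lt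
          exact ⟨p ^ (i + 1) - 2, by omega⟩
        rw [← LieAlgebra.ad_apply (R := F), ad_iterate_pMap, hm, pow_add]
        simp [pow_succ, hE]
    · exact ⟨0, fun z => by simp⟩
    · rintro s t ⟨a, h⟩ ⟨a', h'⟩
      exact ⟨a + a', fun z => by rw [add_lie, h, h', add_smul]⟩
    · rintro c s ⟨a, h⟩
      exact ⟨c * a, fun z => by rw [smul_lie, h, mul_smul]⟩
  have hcentral : ∀ x y z : L, ⁅⁅x, y⁆, z⁆ = 0 := by
    intro x y z
    obtain ⟨s, hs, r, hr, hsr⟩ := Submodule.mem_sup.1 (hQ x y)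
    obtain ⟨a, ha⟩ := hspan hs
    obtain ⟨b, hb⟩ := hspan hr
    have hz : ∀ z, ⁅⁅x, y⁆, z⁆ = a • ⁅x, z⁆ + b • ⁅y, z⁆ := fun z => by
      rw [← ha, ← hb, ← add_lie, hsr]
    by_cases hxy : ⁅x, y⁆ = 0
    · rw [hxy, zero_lie]
    -- `[x, y]` acts as `a ad x + b ad y` but kills `x` and `y`; if `[x, y] ≠ 0` this forces `a = b
    -- = 0`.
    have h1 := hz x
    have h2 := hz y
    have hyx : ⁅y, x⁆ ≠ 0 := by rwa [← lie_skew, neg_ne_zero]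
    have hE' : ⁅y, ⁅x, y⁆⁆ = 0 := by rw [← lie_skew x y, lie_neg, hE, neg_zero]
    rw [← lie_skew, hE, lie_self, neg_zero, smul_zero, zero_add, eq_comm,
      smul_eq_zero_iff_left hyx] at h1
    rw [← lie_skew, hE', lie_self, neg_zero, smul_zero, add_zero, eq_comm,
      smul_eq_zero_iff_left hxy] at h2
    rw [hz, h1, h2, zero_smul, zero_smul, add_zero]
  rw [LieModule.lowerCentralSeries_succ, LieSubmodule.lie_eq_bot_iff]
  intro z _ m hm
  have hle : LieModule.lowerCentralSeries F L L 1 ≤ LieModule.maxTrivSubmodule F L L := by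
    rw [LieModule.lowerCentralSeries_succ, LieSubmodule.lie_le_iff]
    intro x _ y _
    rw [LieModule.mem_maxTrivSubmodule]
    intro z
    rw [← lie_skew, hcentral, neg_zero]
  exact (LieModule.mem_maxTrivSubmodule _ _ _ _).1 (hle hm) z

/-- An upper semimodular lattice of restricted subalgebras belongs to an almost abelian algebra, or
to a nilpotent one. -/
theorem isAlmostAbelian_or_isNilpotent [IsAlgClosed F] [FiniteDimensional F L]
    [IsUpperModularLattice (RestrictedSubalgebra F p L)] :
    IsAlmostAbelian F L ∨ LieRing.IsNilpotent L := by
  by_cases h : ∀ t u : L, φ t = t → ⁅t, u⁆ = 0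
  · exact Or.inr (isNilpotent_of_toral h)
  · push Not at h
    obtain ⟨t, u, ht, htu⟩ := h
    exact Or.inl (isAlmostAbelian_of_toral
      (fun _ _ => lie_mem_span_of_isUpperModularLattice) ht htu)

theorem IsUpperModularLattice.isQuasiIdeal [IsAlgClosed F] [FiniteDimensional F L]
    [IsUpperModularLattice (RestrictedSubalgebra F p L)] (S : RestrictedSubalgebra F p L) :
    S.IsQuasiIdeal := by
  rcases isAlmostAbelian_or_isNilpotent (F := F) (p := p) (L := L) with h | h
  · intro T s hs t ht
    have hle : Submodule.span F {s, t} ≤ S.toSubmodule ⊔ T.toSubmodule := by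
      rw [Submodule.span_le]
      rintro _ (rfl | rfl)
      · exact Submodule.mem_sup_left hs
      · exact Submodule.mem_sup_right ht
    exact hle (h.lie_mem_span s t)
  · exact isQuasiIdeal_of_isUpperModularLattice S

end RestrictedSubalgebra

end Restricted

/-! ### The main theorem -/

theorem mainTheorem1 {F : Type*} [Field F] [IsAlgClosed F] (p : ℕ) [Fact p.Prime] [CharP F p]
    {L : Type*} [LieRing L] [LieAlgebra F L] [FiniteDimensional F L]
    [RestrictedLieAlgebra F p L] :
    [IsUpperModularLattice (RestrictedSubalgebra F p L),
      IsModularLattice (RestrictedSubalgebra F p L),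
      ∀ S : RestrictedSubalgebra F p L, S.IsQuasiIdeal].TFAE ∧
    ((IsUpperModularLattice (RestrictedSubalgebra F p L) ∨
      IsModularLattice (RestrictedSubalgebra F p L) ∨
      ∀ S : RestrictedSubalgebra F p L, S.IsQuasiIdeal) →
      IsAlmostAbelian F L ∨ LieModule.lowerCentralSeries F L L 2 = ⊥) := by
  have h13 : IsUpperModularLattice (RestrictedSubalgebra F p L) →
      ∀ S : RestrictedSubalgebra F p L, S.IsQuasiIdeal := fun _ S =>
    RestrictedSubalgebra.IsUpperModularLattice.isQuasiIdeal S
  have h32 : (∀ S : RestrictedSubalgebra F p L, S.IsQuasiIdeal) →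
      IsModularLattice (RestrictedSubalgebra F p L) :=
    RestrictedSubalgebra.isModularLattice_of_isQuasiIdeal
  have h21 : IsModularLattice (RestrictedSubalgebra F p L) →
      IsUpperModularLattice (RestrictedSubalgebra F p L) := fun _ => inferInstance
  refine ⟨?_, fun h => ?_⟩
  · tfae_have 1 → 3 := h13
    tfae_have 3 → 2 := h32
    tfae_have 2 → 1 := h21
    tfae_finish
  · have h1 : IsUpperModularLattice (RestrictedSubalgebra F p L) := by
      rcases h with h | h | h
      exacts [h, h21 h, h21 (h32 h)]
    rcases RestrictedSubalgebra.isAlmostAbelian_or_isNilpotent (F := F) (p := p) (L := L)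
      with h' | h'
    · exact Or.inl h'
    · exact Or.inr (RestrictedSubalgebra.lowerCentralSeries_two_eq_bot (F := F) (p := p) fun x y =>
        h13 h1 _ _ x (RestrictedSubalgebra.self_mem_pSpan x) y
          (RestrictedSubalgebra.self_mem_pSpan y))
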